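/- Let $n\ge 2$ and let $X_1,\dots,X_n$ be a random sample from the Gamma distribution with unknown shape $\alpha>0$ and rate $\lambda>0$, i.e. with density $\frac{\lambda^\alpha}{\Gamma(\alpha)}x^{\alpha-1}e^{-\lambda x}$, $x>0$. Put $X=\sum_{i=1}^n X_i$ and $Y=\prod_{i=1}^n X_i\big/(X/n)^n$ (so $Y^{1/n}$ is the ratio of the geometric to the arithmetic mean). Define $\gamma_1(0)=1$, $\gamma_1(m)=0$ for $m\ge1$, $$\gamma_{i+1}(m)=\frac{\Gamma\big(m+\frac{i(i+1)}{2n}\big)}{\Gamma\big(m+\frac{(i+1)(i+2)}{2n}\big)}\sum_{k=0}^m\frac{\Gamma\big(m-k+\frac{i+1}{n}\big)}{(m-k)!}\,\gamma_i(k)\qquad(1\le i\le n-2),$$ and, for $0<y<1$ and $x>0$, $$G(y)=\sum_{m=0}^\infty\gamma_{n-1}(m)(1-y)^m,\qquad u_0(y)=\frac{n-3}{2}\,\frac{y}{1-y}-\frac{yG'(y)}{G(y)},\qquad u_1(x,y)=\frac{n\,u_0(y)-1}{x}.$$ An estimator $T(X_1,\dots,X_n)$ is called unbiased for $\lambda$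 on a set $S$ of parameters $(\alpha,\lambda)$ if for all $(\alpha,\lambda)\in S$ it has finite expectation and $\mathbb E_{(\alpha,\lambda)}T=\lambda$. For $S\subseteq(0,\infty)^2$ with nonempty interior, $T$ is called a UMVUE of $\lambda$ on $S$ if it is a Borel function of $(X,Y)$, is unbiased for $\lambda$ on $S$, and for every $(\alpha,\lambda)\in S$ has variance (possibly $+\infty$) at most that of every other estimator that is unbiased for $\lambda$ on $S$. The variance is understood as $+\infty$ whenever the second moment is infinite. (a) If $n\ge4$, then $u_1(X,Y)$ is the UMVUE of $\lambda$ on $\{(\alpha,\lambda):\alpha>1/n,\ \lambda>0\}$; in particular $\mathbb E_{(\alpha,\lambda)}u_1(X,Y)=\lambda$ whenever $n>1/\alpha$. It is unique: every Borel function of $(X,Y)$ that is unbiased for $\lambda$ on this set is almost surely equal to $u_1(X,Y)$. (b) If $n\ge6$, then for all $\alpha,\lambda>0$ the variance of $u_1(X,Y)$ is finite if and only if $\alpha>2/n$. (c) If $n\in\{4,5\}$, then the variance of $u_1(X,Y)$ is infinite for all $\alpha,\lambda>0$. (d) If $n\in\{2,3\}$, then there is no estimator that is unbiased for $\lambda$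 on some subset of $(0,\infty)^2$ with nonempty interior. (e) If $0<\alpha\le 1/n$ (for any $n\ge 2$, in particular for $n\ge4$), then for this fixed $\alpha$ there is no estimator that is unbiased for $\lambda$ for all $\lambda$ in some interval $(\lambda_1,\lambda_2)$, $0\le\lambda_1<\lambda_2$. -/

import Mathlib

open MeasureTheory ProbabilityTheory Set

namespace GammaSample

noncomputable section

/-- The law of a random sample `(X₁, …, Xₙ)` from the Gamma distribution with shape `θ.1 = α`
and rate `θ.2 = λ`, on the sample space `ℝⁿ`. -/
def law (n : ℕ) (θ : ℝ × ℝ) : Measure (Fin n → ℝ) :=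
  Measure.pi fun _ => gammaMeasure θ.1 θ.2

/-- The parameter space `(0, ∞)²` of pairs `(α, λ)`. -/
def parameterSpace : Set (ℝ × ℝ) := Ioi 0 ×ˢ Ioi 0

/-- The statistic `X = X₁ + ⋯ + Xₙ`. -/
def statX {n : ℕ} (x : Fin n → ℝ) : ℝ := ∑ i, x i

/-- The statistic `Y`, the `n`-th power of the ratio of the geometric to the arithmetic mean
(for positive data). -/
def statY {n : ℕ} (x : Fin n → ℝ) : ℝ := (∏ i, x i) / ((∑ i, x i) / n) ^ n

/-- The coefficients `γᵢ(m)`, `i ≥ 1` (the value at `i = 0` is a dummy):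
`γ₁(m) = 1` if `m = 0` and `0` otherwise, and
`γᵢ₊₁(m) = Γ(m + i(i+1)/(2n)) / Γ(m + (i+1)(i+2)/(2n)) *
  ∑_{k ≤ m} Γ(m - k + (i+1)/n) / (m - k)! * γᵢ(k)`, where below `i = j + 1`. -/
def gammaCoeff (n : ℕ) : ℕ → ℕ → ℝ
  | 0, _ => 0
  | 1, m => if m = 0 then 1 else 0
  | j + 2, m =>
      Real.Gamma (m + ((j : ℝ) + 1) * (j + 2) / (2 * n)) /
          Real.Gamma (m + ((j : ℝ) + 2) * (j + 3) / (2 * n)) *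
        ∑ k ∈ Finset.range (m + 1),
          Real.Gamma (((m - k : ℕ) : ℝ) + ((j : ℝ) + 2) / n) / ((m - k).factorial : ℝ) *
            gammaCoeff n (j + 1) k

/-- `G(y) = ∑ₘ dₘ (1 - y)^m` for `0 < y < 1`, with `dₘ = γₙ₋₁(m)`. -/
def G (n : ℕ) (y : ℝ) : ℝ := ∑' m : ℕ, gammaCoeff n (n - 1) m * (1 - y) ^ m

/-- `u₀(y) = ((n - 3) / 2) y / (1 - y) - y G'(y) / G(y)`. -/
def u₀ (n : ℕ) (y : ℝ) : ℝ :=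
  ((n : ℝ) - 3) / 2 * (y / (1 - y)) - y * deriv (G n) y / G n y

/-- `u₁(x, y) = (n u₀(y) - 1) / x`. -/
def u₁ (n : ℕ) (x y : ℝ) : ℝ := (n * u₀ n y - 1) / x

/-- The estimator `u₁(X, Y)`. -/
def rateEstimator (n : ℕ) (x : Fin n → ℝ) : ℝ := u₁ n (statX x) (statY x)

/-- The estimator `T` has finite expectation and is unbiased for `h(α, λ)`,
for all `(α, λ)` in `S`. -/
def UnbiasedOn (n : ℕ) (T : (Fin n → ℝ) → ℝ) (h : ℝ × ℝ → ℝ) (S : Set (ℝ × ℝ)) : Prop :=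
  ∀ θ ∈ S, Integrable T (law n θ) ∧ ∫ x, T x ∂(law n θ) = h θ

/-- `T` is a uniformly minimum variance unbiased estimator of `h(α, λ)` on the set `S` of
parameters, where `S` has nonempty interior: `T` is a Borel function of `(X, Y)`, it is unbiased
on `S`, and its (possibly infinite) variance is at most that of any other estimator that is
unbiased on `S`, for all parameters in `S`. -/
structure IsUMVUEOn (n : ℕ) (T : (Fin n → ℝ) → ℝ) (h : ℝ × ℝ → ℝ) (S : Set (ℝ × ℝ)) : Prop where
  subset : S ⊆ parameterSpace
  nonempty_interior : (interior S).Nonempty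
  factors : ∃ u : ℝ × ℝ → ℝ, Measurable u ∧
    ∀ x : Fin n → ℝ, (∀ i, 0 < x i) → T x = u (statX x, statY x)
  unbiased : UnbiasedOn n T h S
  min_variance : ∀ T' : (Fin n → ℝ) → ℝ, UnbiasedOn n T' h S →
    ∀ θ ∈ S, evariance T (law n θ) ≤ evariance T' (law n θ)

end

end GammaSample

open scoped Topology ENNReal

/-! The laws form an exponential family with statistics `∑ log Xᵢ` and `X`, equivalently `X` and
`Y`, and uniqueness of Laplace transforms makes `(X, Y)` complete on any parameter set with
interior. Matching joint transforms and applying the Gamma multiplication formula shows that `X` and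
`Y` are independent, `X` being Gamma with shape `nα`, and that `Y` has the Mellin transform of a
product of independent Beta(`α`, `k/n`) variables, `1 ≤ k ≤ n - 1`. The recursion for `γᵢ`
multiplies in one Beta factor at a time, so `Y` has density proportional to `y^(α-1) k(y)` with
`k(y) = (1-y)^((n-3)/2) G(y)` (`lintegral_kernelY`, `map_statX_statY`).

Since `u₀ = -y k'/k`, integration by parts gives `E u₀(Y) = α`; the boundary term at `y = 1`
vanishes exactly because `n > 3`. With `E[1/X] = λ/(nα - 1)` and independence, `u₁(X, Y)` is
unbiased. By completeness it is the conditional expectation given `(X, Y)` of every other unbiased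
estimator, hence has the smaller variance, and it is unique (`evariance_le_of_unbiasedOn`,
`ae_eq_zero_of_unbiasedOn_zero`).

The second moment factors into `E[X⁻²]`, finite iff `nα > 2`, and `E[(n u₀(Y) - 1)²]`. The latter
integrand behaves like `(1-y)^((n-7)/2)` near `1`, so it is finite iff `n ≥ 6`.

Both nonexistence results rest on one contradiction: unbiasedness on a small set fixes a Laplace
transform of `T` locally, analyticity fixes it on a half-line, and dominated convergence forces it
to vanish at infinity. For `α ≤ 1/n` the prescribed function is `l^(nα) (l+t)^(1-nα)`, which does
not decay. For `n = 2, 3` it is a constant times `(n(α+s) - 1)` times the Mellin transform at `α+s`;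
the transform decays only like `s^(-(n-1)/2)`, so the product stays away from `0`. -/

namespace GammaSample

/-! ### Laplace transforms: uniqueness, analyticity, decay. -/

/-- The complex moment generating functions of finite measures agree on the imaginary axis as soon
as the moment generating functions agree near `0`. -/
lemma complexMGF_I_eq_of_mgf_eq {Ω : Type*} {mΩ : MeasurableSpace Ω} {X : Ω → ℝ}
    {μ ν : Measure Ω} {δ : ℝ} (hδ : 0 < δ)
    (hμ : ∀ t, |t| < δ → Integrable (fun ω => Real.exp (t * X ω)) μ)
    (hν : ∀ t, |t| < δ → Integrable (fun ω => Real.exp (t * X ω)) ν)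
    (h : ∀ t, |t| < δ → mgf X μ t = mgf X ν t) :
    complexMGF X μ Complex.I = complexMGF X ν Complex.I := by
  have key : ∀ ρ : Measure Ω, (∀ t, |t| < δ → Integrable (fun ω => Real.exp (t * X ω)) ρ) →
      Ioo (-δ) δ ⊆ interior (integrableExpSet X ρ) := fun ρ hρ =>
    interior_maximal (fun t ht => hρ t (abs_lt.2 ht)) isOpen_Ioo
  have hX : AnalyticOnNhd ℂ (complexMGF X μ) {z | z.re ∈ Ioo (-δ) δ} := fun z hz =>
    analyticAt_complexMGF (key μ hμ hz)
  have hY : AnalyticOnNhd ℂ (complexMGF X ν) {z | z.re ∈ Ioo (-δ) δ} := fun z hz =>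
    analyticAt_complexMGF (key ν hν hz)
  -- The strip `|Re z| < δ` is connected and contains both the real interval, where the functions
  -- agree, and `I`.
  refine AnalyticOnNhd.eqOn_of_preconnected_of_frequently_eq hX hY
    ((convex_Ioo (-δ) δ).linear_preimage Complex.reLm).isPreconnected
    (z₀ := ((0 : ℝ) : ℂ)) (by simp [hδ]) ?_ (by simp [hδ])
  have h_real : ∃ᶠ x : ℝ in 𝓝[≠] 0, complexMGF X μ x = complexMGF X ν x := by
    refine Filter.Eventually.frequently ?_
    filter_upwards [nhdsWithin_le_nhds (Ioo_mem_nhds (neg_lt_zero.2 hδ) hδ)] with y hy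
    rw [complexMGF_ofReal, complexMGF_ofReal, h y (abs_lt.2 hy)]
  rw [Filter.frequently_iff_seq_forall] at h_real ⊢
  obtain ⟨xs, hx_tendsto, hx_eq⟩ := h_real
  refine ⟨fun n ↦ xs n, ?_, fun n ↦ hx_eq n⟩
  rw [tendsto_nhdsWithin_iff] at hx_tendsto ⊢
  constructor
  · exact (Complex.continuous_ofReal.tendsto 0).comp hx_tendsto.1
  · simpa using hx_tendsto.2

/-- Two finite measures on the plane with equal moment generating functions near `0` are equal. -/
lemma measure_ext_of_integral_exp_eq {μ ν : Measure (ℝ × ℝ)} [IsFiniteMeasure μ]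
    [IsFiniteMeasure ν] {ε : ℝ} (hε : 0 < ε)
    (hμ : ∀ s t, |s| < ε → |t| < ε →
      Integrable (fun p : ℝ × ℝ => Real.exp (s * p.1 + t * p.2)) μ)
    (hν : ∀ s t, |s| < ε → |t| < ε →
      Integrable (fun p : ℝ × ℝ => Real.exp (s * p.1 + t * p.2)) ν)
    (h : ∀ s t, |s| < ε → |t| < ε →
      ∫ p, Real.exp (s * p.1 + t * p.2) ∂μ = ∫ p, Real.exp (s * p.1 + t * p.2) ∂ν) :
    μ = ν := by
  refine Measure.ext_of_charFunDual (funext fun l => ?_)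
  set a := l (1, 0)
  set b := l (0, 1)
  have hl : ∀ p : ℝ × ℝ, l p = a * p.1 + b * p.2 := fun p => by
    have : p = p.1 • ((1 : ℝ), (0 : ℝ)) + p.2 • ((0 : ℝ), (1 : ℝ)) := by ext <;> simp
    conv_lhs => rw [this]
    rw [map_add, map_smul, map_smul]
    simp only [smul_eq_mul]
    ring
  -- This radius keeps `t • (a, b)` inside the `ε`-box, so the one-dimensional uniqueness applies to
  -- each linear functional `l`.
  have hδ : 0 < ε / (1 + |a| + |b|) := by positivity
  have bound : ∀ t, |t| < ε / (1 + |a| + |b|) → |t * a| < ε ∧ |t * b| < ε := fun t ht => by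
    rw [lt_div_iff₀ (by positivity)] at ht
    rw [abs_mul, abs_mul]
    constructor <;> nlinarith [abs_nonneg t, abs_nonneg a, abs_nonneg b,
      mul_nonneg (abs_nonneg t) (abs_nonneg a), mul_nonneg (abs_nonneg t) (abs_nonneg b)]
  have e : ∀ (t : ℝ) (p : ℝ × ℝ), t * l p = t * a * p.1 + t * b * p.2 := fun t p => by
    rw [hl]; ring
  have := complexMGF_I_eq_of_mgf_eq (X := fun p => l p) (μ := μ) (ν := ν) hδ
    (fun t ht => by simpa only [e] using hμ _ _ (bound t ht).1 (bound t ht).2)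
    (fun t ht => by simpa only [e] using hν _ _ (bound t ht).1 (bound t ht).2)
    (fun t ht => by simpa only [mgf, e] using h _ _ (bound t ht).1 (bound t ht).2)
  simpa only [complexMGF, charFunDual_apply, mul_comm Complex.I] using this

/-- An integrable function integrates like the difference of its positive and negative parts,
viewed as densities. -/
lemma integral_mul_eq_sub_withDensity {Ω : Type*} {mΩ : MeasurableSpace Ω} {μ : Measure Ω}
    {T f : Ω → ℝ} (hT : AEMeasurable T μ) (h : Integrable (fun ω => T ω * f ω) μ) :
    Integrable f (μ.withDensity fun ω => ENNReal.ofReal (T ω)) ∧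
    Integrable f (μ.withDensity fun ω => ENNReal.ofReal (-T ω)) ∧
    ∫ ω, T ω * f ω ∂μ = ∫ ω, f ω ∂(μ.withDensity fun ω => ENNReal.ofReal (T ω)) -
      ∫ ω, f ω ∂(μ.withDensity fun ω => ENNReal.ofReal (-T ω)) := by
  have aux : ∀ S : Ω → ℝ, AEMeasurable S μ → Integrable (fun ω => S ω * f ω) μ →
      Integrable (fun ω => (ENNReal.ofReal (S ω)).toReal * f ω) μ := fun S hS hSf => by
    have : (fun ω => (ENNReal.ofReal (S ω)).toReal * f ω) =
        {ω | 0 < S ω}.indicator (fun ω => S ω * f ω) := by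
      ext ω
      by_cases hω : 0 < S ω
      · simp [hω, hω.le]
      · simp [hω, ENNReal.ofReal_of_nonpos (not_lt.1 hω)]
    rw [this]
    exact hSf.indicator₀ (nullMeasurableSet_lt aemeasurable_const hS)
  have h1 := aux T hT h
  have h2 := aux (fun ω => -T ω) hT.neg (by simpa using h.neg)
  have m1 : AEMeasurable (fun ω => ENNReal.ofReal (T ω)) μ := hT.ennreal_ofReal
  have m2 : AEMeasurable (fun ω => ENNReal.ofReal (-T ω)) μ := hT.neg.ennreal_ofReal
  have f1 : ∀ᵐ ω ∂μ, ENNReal.ofReal (T ω) < ∞ := by simp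
  have f2 : ∀ᵐ ω ∂μ, ENNReal.ofReal (-T ω) < ∞ := by simp
  refine ⟨(integrable_withDensity_iff_integrable_smul₀' m1 f1).2 (by simpa using h1),
    (integrable_withDensity_iff_integrable_smul₀' m2 f2).2 (by simpa using h2), ?_⟩
  rw [integral_withDensity_eq_integral_toReal_smul₀ m1 f1,
    integral_withDensity_eq_integral_toReal_smul₀ m2 f2,
    ← integral_sub (by simpa using h1) (by simpa using h2)]
  refine integral_congr_ae (.of_forall fun ω => ?_)
  simp only [smul_eq_mul, ← sub_mul, ENNReal.toReal_ofReal']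
  rcases le_total 0 (T ω) with h | h <;> simp [h]

/-- If the Laplace transform of `T` along `(U, V)` vanishes near `0`, then `T` is orthogonal to all
functions of `(U, V)`. -/
lemma integral_mul_comp_eq_zero {Ω : Type*} {mΩ : MeasurableSpace Ω} {μ : Measure Ω}
    {T U V : Ω → ℝ} (hU : Measurable U) (hV : Measurable V) {ε : ℝ} (hε : 0 < ε)
    (hint : ∀ s t, |s| < ε → |t| < ε → Integrable (fun ω => T ω * Real.exp (s * U ω + t * V ω)) μ)
    (hzero : ∀ s t, |s| < ε → |t| < ε → ∫ ω, T ω * Real.exp (s * U ω + t * V ω) ∂μ = 0)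
    {φ : ℝ × ℝ → ℝ} (hφ : Measurable φ) (hi : Integrable (fun ω => T ω * φ (U ω, V ω)) μ) :
    ∫ ω, T ω * φ (U ω, V ω) ∂μ = 0 := by
  have hT : Integrable T μ := by simpa using hint 0 0 (by simpa) (by simpa)
  have hTm := hT.aemeasurable
  have hUV : Measurable fun ω => (U ω, V ω) := hU.prodMk hV
  set μ₁ := μ.withDensity fun ω => ENNReal.ofReal (T ω)
  set μ₂ := μ.withDensity fun ω => ENNReal.ofReal (-T ω)
  have : IsFiniteMeasure μ₁ := isFiniteMeasure_withDensity_ofReal hT.2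
  have : IsFiniteMeasure μ₂ := isFiniteMeasure_withDensity_ofReal hT.neg.2
  have hexp : ∀ s t : ℝ, Measurable fun p : ℝ × ℝ => Real.exp (s * p.1 + t * p.2) := by
    intro s t; fun_prop
  -- The positive and negative parts of `T μ`, pushed to the plane, are finite measures with equal
  -- Laplace transforms. Their equality allows any measurable `φ` with `T φ` integrable, bounded or
  -- not.
  have key : μ₁.map (fun ω => (U ω, V ω)) = μ₂.map (fun ω => (U ω, V ω)) := by
    refine measure_ext_of_integral_exp_eq hε (fun s t hs ht => ?_) (fun s t hs ht => ?_)
      (fun s t hs ht => ?_)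
    · rw [integrable_map_measure (hexp s t).aestronglyMeasurable hUV.aemeasurable]
      exact (integral_mul_eq_sub_withDensity hTm (hint s t hs ht)).1
    · rw [integrable_map_measure (hexp s t).aestronglyMeasurable hUV.aemeasurable]
      exact (integral_mul_eq_sub_withDensity hTm (hint s t hs ht)).2.1
    · rw [integral_map hUV.aemeasurable (hexp s t).aestronglyMeasurable,
        integral_map hUV.aemeasurable (hexp s t).aestronglyMeasurable, ← sub_eq_zero,
        ← (integral_mul_eq_sub_withDensity hTm (hint s t hs ht)).2.2, hzero s t hs ht]
  rw [(integral_mul_eq_sub_withDensity hTm hi).2.2,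
    ← integral_map (φ := fun ω => (U ω, V ω)) hUV.aemeasurable hφ.aestronglyMeasurable,
    ← integral_map (φ := fun ω => (U ω, V ω)) hUV.aemeasurable hφ.aestronglyMeasurable, key,
    sub_self]

/-- The Laplace transform of an integrable function along a nonpositive exponent is analytic. -/
lemma analyticOnNhd_integral_mul_exp {Ω : Type*} {mΩ : MeasurableSpace Ω} {μ : Measure Ω}
    {f W : Ω → ℝ} (hf : Integrable f μ) (hW : Measurable W) (hneg : ∀ᵐ ω ∂μ, W ω ≤ 0) :
    AnalyticOnNhd ℝ (fun t => ∫ ω, f ω * Real.exp (t * W ω) ∂μ) (Ioi 0) := by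
  have hi : ∀ t, 0 ≤ t → Integrable (fun ω => f ω * Real.exp (t * W ω)) μ := fun t ht => by
    refine hf.mul_bdd (c := 1) (by fun_prop) ?_
    filter_upwards [hneg] with ω hω
    simpa using mul_nonpos_of_nonneg_of_nonpos ht hω
  have hfm := hf.aemeasurable
  have key : ∀ ρ : Measure Ω, (∀ t, 0 ≤ t → Integrable (fun ω => Real.exp (t * W ω)) ρ) →
      AnalyticOnNhd ℝ (mgf W ρ) (Ioi 0) := fun ρ hρ t ht =>
    analyticAt_mgf (interior_maximal (fun s (hs : 0 < s) => hρ s hs.le) isOpen_Ioi ht)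
  have h1 := key _ fun t ht => (integral_mul_eq_sub_withDensity hfm (hi t ht)).1
  have h2 := key _ fun t ht => (integral_mul_eq_sub_withDensity hfm (hi t ht)).2.1
  refine (h1.sub h2).congr isOpen_Ioi fun t (ht : 0 < t) => ?_
  exact (integral_mul_eq_sub_withDensity hfm (hi t ht.le)).2.2.symm

/-- Strict negativity of `W` makes the exponential tend to `0` pointwise, with `|f|` as majorant.
This decay is what the nonexistence results contradict. -/
lemma tendsto_integral_mul_exp_atTop {Ω : Type*} {mΩ : MeasurableSpace Ω} {μ : Measure Ω}
    {f W : Ω → ℝ} (hf : Integrable f μ) (hW : Measurable W) (hneg : ∀ᵐ ω ∂μ, W ω < 0) :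
    Filter.Tendsto (fun t => ∫ ω, f ω * Real.exp (t * W ω) ∂μ) Filter.atTop (𝓝 0) := by
  rw [← integral_zero Ω ℝ (μ := μ)]
  refine tendsto_integral_filter_of_dominated_convergence (fun ω => ‖f ω‖)
    (.of_forall fun t => hf.1.mul (by fun_prop)) ?_ hf.norm ?_
  · filter_upwards [Filter.eventually_ge_atTop 0] with t ht
    filter_upwards [hneg] with ω hω
    rw [norm_mul]
    refine mul_le_of_le_one_right (norm_nonneg _) ?_
    simpa using mul_nonpos_of_nonneg_of_nonpos ht hω.le
  · filter_upwards [hneg] with ω hω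
    rw [← mul_zero (f ω)]
    refine Filter.Tendsto.const_mul _ (Real.tendsto_exp_atBot.comp ?_)
    exact Filter.tendsto_id.atTop_mul_const_of_neg hω

/-! ### Gamma function identities and Beta integrals. -/

/-- The multiplication formula for the Gamma function, up to the value of the constant. -/
lemma exists_Gamma_nat_mul_eq {n : ℕ} (hn : 0 < n) :
    ∃ C : ℝ, 0 < C ∧ ∀ x : ℝ, 0 < x → Real.Gamma (n * x) =
      C * (n : ℝ) ^ (n * x) * ∏ k ∈ Finset.range n, Real.Gamma (x + k / n) := by
  have hn' : (0 : ℝ) < n := by exact_mod_cast hn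
  -- By Bohr–Mollerup in the variable `z = n x`, `h z / h 1` is the Gamma function: it is
  -- log-convex, satisfies the functional equation and equals `1` at `1`.
  set h : ℝ → ℝ := fun z => (n : ℝ) ^ z * ∏ k ∈ Finset.range n, Real.Gamma ((z + k) / n) with hh
  have harg : ∀ z : ℝ, 0 < z → ∀ k : ℕ, 0 < (z + k) / n := fun z hz k => by positivity
  have hΓ : ∀ z : ℝ, 0 < z → ∀ k : ℕ, 0 < Real.Gamma ((z + k) / n) := fun z hz k =>
    Real.Gamma_pos_of_pos (harg z hz k)
  have hpos : ∀ z : ℝ, 0 < z → 0 < h z := fun z hz =>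
    mul_pos (by positivity) (Finset.prod_pos fun k _ => hΓ z hz k)
  have hlog : ∀ z : ℝ, 0 < z → Real.log (h z / h 1) =
      z * Real.log n + ∑ k ∈ Finset.range n, Real.log (Real.Gamma ((z + k) / n))
        - Real.log (h 1) := fun z hz => by
    rw [Real.log_div (hpos z hz).ne' (hpos 1 one_pos).ne', hh]
    simp only
    rw [Real.log_mul (by positivity) (Finset.prod_pos fun k _ => hΓ z hz k).ne',
      Real.log_rpow hn', Real.log_prod fun k _ => (hΓ z hz k).ne']
  have hconv : ConvexOn ℝ (Ioi 0) (Real.log ∘ fun z => h z / h 1) := by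
    refine ⟨convex_Ioi 0, fun x hx y hy a b ha hb hab => ?_⟩
    have hxy : 0 < a • x + b • y := (convex_Ioi (0 : ℝ)) hx hy ha hb hab
    simp only [Function.comp_apply]
    rw [hlog _ hxy, hlog x hx, hlog y hy]
    have hk : ∑ k ∈ Finset.range n, Real.log (Real.Gamma ((a • x + b • y + k) / n)) ≤
        a * ∑ k ∈ Finset.range n, Real.log (Real.Gamma ((x + k) / n)) +
        b * ∑ k ∈ Finset.range n, Real.log (Real.Gamma ((y + k) / n)) := by
      rw [Finset.mul_sum, Finset.mul_sum, ← Finset.sum_add_distrib]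
      refine Finset.sum_le_sum fun k _ => ?_
      have := Real.convexOn_log_Gamma.2 (harg x hx k) (harg y hy k) ha hb hab
      have e : (a • x + b • y + k) / n = a • ((x + k) / n) + b • ((y + k) / n) := by
        simp only [smul_eq_mul]
        have : (k : ℝ) = a * k + b * k := by rw [← add_mul, hab, one_mul]
        conv_lhs => rw [this]
        ring
      rw [e]
      exact this
    simp only [smul_eq_mul] at hk ⊢
    have e : Real.log (h 1) = a * Real.log (h 1) + b * Real.log (h 1) := by
      rw [← add_mul, hab, one_mul]
    nlinarith
  have hfeq : ∀ {y : ℝ}, 0 < y → h (y + 1) / h 1 = y * (h y / h 1) := fun {y} hy => by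
    rw [mul_div_assoc']
    congr 1
    simp only [hh]
    -- Replacing `y` by `y + 1` shifts `k` to `k + 1`, so only the factors `k = 0` and `k = n`
    -- matter. The product over `n + 1` factors is split off at each end.
    have h1 := Finset.prod_range_succ (fun k : ℕ => Real.Gamma ((y + k) / n)) n
    rw [Finset.prod_range_succ', show (y + n) / n = y / n + 1 by field_simp,
      Real.Gamma_add_one (by positivity)] at h1
    have e : ∀ k : ℕ, (y + 1 + k) / n = (y + (k + 1 : ℕ)) / n := fun k => by push_cast; ring
    have h0 : Real.Gamma (y / n) ≠ 0 := (Real.Gamma_pos_of_pos (by positivity)).ne'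
    simp only [Nat.cast_zero, add_zero] at h1
    rw [← mul_assoc, mul_eq_mul_right_iff, or_iff_left h0] at h1
    simp only [e, h1, Real.rpow_add_one hn'.ne']
    field_simp
  have := Real.eq_Gamma_of_log_convex hconv hfeq (fun hy => div_pos (hpos _ hy) (hpos 1 one_pos))
    (div_self (hpos 1 one_pos).ne')
  refine ⟨(h 1)⁻¹, inv_pos.2 (hpos 1 one_pos), fun x hx => ?_⟩
  have hnx : (0 : ℝ) < n * x := by positivity
  rw [← this hnx]
  simp only [hh]
  have e : ∀ k : ℕ, (n * x + k) / n = x + k / n := fun k => by field_simp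
  simp only [e]
  ring

lemma lintegral_rpow_mul_one_sub_rpow {a b : ℝ} (ha : 0 < a) (hb : 0 < b) :
    ∫⁻ y in Ioo (0 : ℝ) 1, ENNReal.ofReal (y ^ (a - 1) * (1 - y) ^ (b - 1)) =
      ENNReal.ofReal (Real.Gamma a * Real.Gamma b / Real.Gamma (a + b)) := by
  have h := lintegral_betaPDF_eq_one ha hb
  have hB := beta_pos ha hb
  rw [lintegral_betaPDF] at h
  simp only [mul_assoc, ENNReal.ofReal_mul (one_div_pos.2 hB).le] at h
  rw [lintegral_const_mul _ (by fun_prop), one_div, ENNReal.ofReal_inv_of_pos hB] at h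
  rw [← beta]
  rw [mul_comm] at h
  rw [ENNReal.eq_inv_of_mul_eq_one_left h, inv_inv]

/-- Binomial series of `(1 - t)^(-b)`, as `Γ(j + b) = Γ(b) b (b+1) ⋯ (b+j-1)`. -/
lemma hasSum_Gamma_div_factorial {b t : ℝ} (hb : 0 < b) (ht0 : 0 ≤ t) (ht : t < 1) :
    HasSum (fun j : ℕ => Real.Gamma (j + b) / j.factorial * t ^ j)
      (Real.Gamma b * (1 - t) ^ (-b)) := by
  have h := (Real.one_div_one_sub_rpow_hasFPowerSeriesOnBall_zero b).hasSum (y := t)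
    (by simpa [enorm_eq_nnnorm, ← NNReal.coe_lt_coe, abs_of_nonneg ht0] using ht)
  have hΓ : ∀ j : ℕ, Real.Gamma (j + b) = Real.Gamma b * (ascPochhammer ℝ j).eval b := fun j => by
    induction j with
    | zero => simp
    | succ j ih =>
      rw [ascPochhammer_succ_eval, ← mul_assoc, ← ih, Nat.cast_succ,
        show (j : ℝ) + 1 + b = (j + b) + 1 by ring, Real.Gamma_add_one (by positivity)]
      ring
  have hc : ∀ j : ℕ, Real.Gamma (j + b) / j.factorial =
      Real.Gamma b * Ring.choose (b + j - 1) j := fun j => by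
    have := Ring.factorial_nsmul_multichoose_eq_ascPochhammer b j
    rw [Polynomial.ascPochhammer_smeval_eq_eval, nsmul_eq_mul] at this
    rw [hΓ, ← Ring.multichoose_eq, ← this]
    field_simp
  have hbin := h.mul_left (Real.Gamma b)
  simp only [zero_add, one_div, ← Real.rpow_neg (sub_pos.2 ht).le] at hbin
  have e : (fun j : ℕ => Real.Gamma (j + b) / j.factorial * t ^ j) = fun j => Real.Gamma b *
      (FormalMultilinearSeries.ofScalars ℝ (fun j : ℕ => Ring.choose (b + j - 1) j) j)
        fun _ => t := by
    ext j
    simp [hc]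
    ring
  rw [e]
  exact hbin

/-- Tonelli for a Cauchy product. -/
lemma tsum_sum_range_eq_tsum_tsum (f : ℕ → ℕ → ℝ≥0∞) :
    ∑' m, ∑ k ∈ Finset.range (m + 1), f k (m - k) = ∑' k, ∑' j, f k j := by
  rw [← ENNReal.tsum_prod, ← Finset.HasAntidiagonal.sigmaAntidiagonalEquivProd.tsum_eq, ENNReal.tsum_sigma']
  refine tsum_congr fun m => ?_
  rw [tsum_fintype, ← Finset.Nat.sum_antidiagonal_eq_sum_range_succ f m]
  exact (Finset.sum_coe_sort _ (fun p : ℕ × ℕ => f p.1 p.2)).symm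

/-- This is Gauss's summation of `₂F₁(b, A; α + b + A; 1)`. Each Gamma quotient is a Beta integral;
summing under the integral produces `(1 - y)^(-b)`, which leaves a single Beta integral. -/
lemma tsum_Gamma_eq {A b α : ℝ} (hA : 0 < A) (hb : 0 < b) (hα : 0 < α) :
    ∑' j : ℕ, ENNReal.ofReal (Real.Gamma (j + b) / j.factorial *
      (Real.Gamma (A + j) / Real.Gamma (α + b + (A + j)))) =
    ENNReal.ofReal (Real.Gamma b * Real.Gamma α / Real.Gamma (α + b) *
      (Real.Gamma A / Real.Gamma (α + A))) := by
  have hd : 0 < α + b := by positivity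
  have hΓd := Real.Gamma_pos_of_pos hd
  have hΓb := Real.Gamma_pos_of_pos hb
  have hβ : ∀ j : ℕ, 0 ≤ Real.Gamma (j + b) / j.factorial := fun j => by positivity
  have h1 : ∀ j : ℕ, ENNReal.ofReal (Real.Gamma (j + b) / j.factorial *
      (Real.Gamma (A + j) / Real.Gamma (α + b + (A + j)))) =
      ∫⁻ y in Ioo (0 : ℝ) 1, ENNReal.ofReal (Real.Gamma (α + b))⁻¹ *
        ENNReal.ofReal (Real.Gamma (j + b) / j.factorial *
          (y ^ (A + j - 1) * (1 - y) ^ (α + b - 1))) := fun j => by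
    rw [lintegral_const_mul _ (by fun_prop)]
    simp only [ENNReal.ofReal_mul (hβ j)]
    rw [lintegral_const_mul _ (by fun_prop),
      lintegral_rpow_mul_one_sub_rpow (a := A + j) (by positivity) hd,
      ← ENNReal.ofReal_mul (hβ j), ← ENNReal.ofReal_mul (hβ j),
      ← ENNReal.ofReal_mul (by positivity)]
    congr 1
    rw [add_comm (A + j) (α + b)]
    field_simp
  rw [tsum_congr h1, ← lintegral_tsum (fun j => by fun_prop)]
  have h2 : ∀ y ∈ Ioo (0 : ℝ) 1, ∑' j : ℕ, ENNReal.ofReal (Real.Gamma (α + b))⁻¹ *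
        ENNReal.ofReal (Real.Gamma (j + b) / j.factorial *
          (y ^ (A + j - 1) * (1 - y) ^ (α + b - 1))) =
      ENNReal.ofReal ((Real.Gamma (α + b))⁻¹ * Real.Gamma b) *
        ENNReal.ofReal (y ^ (A - 1) * (1 - y) ^ (α - 1)) := fun y ⟨hy0, hy1⟩ => by
    have hy' : 0 < 1 - y := by linarith
    have hs := (hasSum_Gamma_div_factorial hb hy0.le hy1).mul_left
      (y ^ (A - 1) * (1 - y) ^ (α + b - 1))
    have e : ∀ j : ℕ, Real.Gamma (j + b) / j.factorial *
          (y ^ (A + j - 1) * (1 - y) ^ (α + b - 1)) =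
        y ^ (A - 1) * (1 - y) ^ (α + b - 1) * (Real.Gamma (j + b) / j.factorial * y ^ j) :=
      fun j => by
        rw [show A + j - 1 = (A - 1) + j by ring, Real.rpow_add hy0, Real.rpow_natCast]; ring
    rw [ENNReal.tsum_mul_left, ENNReal.ofReal_mul (by positivity), mul_assoc]
    congr 1
    simp only [e]
    rw [← ENNReal.ofReal_tsum_of_nonneg (fun j => by positivity) hs.summable, hs.tsum_eq,
      ← ENNReal.ofReal_mul hΓb.le]
    congr 1
    rw [show α + b - 1 = (α - 1) + b by ring, Real.rpow_add hy', Real.rpow_neg hy'.le]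
    have : (1 - y) ^ b ≠ 0 := (Real.rpow_pos_of_pos hy' b).ne'
    field_simp
  rw [setLIntegral_congr_fun measurableSet_Ioo h2, lintegral_const_mul _ (by fun_prop),
    lintegral_rpow_mul_one_sub_rpow hA hα, ← ENNReal.ofReal_mul (by positivity)]
  congr 1
  rw [add_comm A α]
  ring

/-! ### The coefficients `γᵢ`: growth and Mellin sums. -/

lemma gammaCoeff_nonneg {n : ℕ} (hn : 0 < n) (i m : ℕ) : 0 ≤ gammaCoeff n i m := by
  induction i using Nat.twoStepInduction generalizing m with
  | zero => simp [gammaCoeff]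
  | one => simp only [gammaCoeff]; split_ifs <;> simp
  | more j _ ih =>
    rw [gammaCoeff]
    have hn' : (0 : ℝ) < n := by exact_mod_cast hn
    refine mul_nonneg (by positivity) (Finset.sum_nonneg fun k _ => mul_nonneg ?_ (ih k))
    positivity

lemma gammaCoeff_zero_pos {n : ℕ} (hn : 0 < n) (j : ℕ) : 0 < gammaCoeff n (j + 1) 0 := by
  have hn' : (0 : ℝ) < n := by exact_mod_cast hn
  induction j with
  | zero => simp [gammaCoeff]
  | succ j ih =>
    rw [gammaCoeff]
    simp only [zero_add, Finset.sum_range_one]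
    positivity

/-- For the generating function `g` of `c`, the condition `hc` reads `(1 - x) g' ≤ C g`
coefficientwise. By the product rule it survives multiplication, and the constants add. -/
lemma add_one_mul_sum_range_le {β c : ℕ → ℝ} {b C : ℝ} (hβ : ∀ j, 0 ≤ β j)
    (hβs : ∀ j : ℕ, (j + 1) * β (j + 1) = (j + b) * β j)
    (hc : ∀ m : ℕ, (m + 1) * c (m + 1) ≤ (m + C) * c m) (m : ℕ) :
    (m + 1) * ∑ k ∈ Finset.range (m + 1 + 1), β (m + 1 - k) * c k ≤
      (m + (b + C)) * ∑ k ∈ Finset.range (m + 1), β (m - k) * c k := by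
  have h1 : (m + 1) * ∑ k ∈ Finset.range (m + 1 + 1), β (m + 1 - k) * c k =
      ∑ k ∈ Finset.range (m + 1 + 1), ((m + 1 - k : ℕ) : ℝ) * β (m + 1 - k) * c k +
      ∑ k ∈ Finset.range (m + 1 + 1), β (m + 1 - k) * (k * c k) := by
    rw [Finset.mul_sum, ← Finset.sum_add_distrib]
    refine Finset.sum_congr rfl fun k hk => ?_
    rw [Nat.cast_sub (Finset.mem_range_succ_iff.1 hk)]
    push_cast
    ring
  -- The weight `m + 1` was split as `(m + 1 - k) + k`. The first sum loses its last term and the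
  -- second its first one, both being zero, so that the two can be compared over `k ≤ m`.
  rw [h1, Finset.sum_range_succ, Finset.sum_range_succ' (fun k => β (m + 1 - k) * (k * c k)),
    Finset.mul_sum]
  simp only [Nat.sub_self, Nat.cast_zero, zero_mul, add_zero, mul_zero, Nat.add_sub_add_right]
  rw [← Finset.sum_add_distrib]
  refine Finset.sum_le_sum fun k hk => ?_
  have hk' : k ≤ m := Finset.mem_range_succ_iff.1 hk
  have e : m + 1 - k = (m - k) + 1 := by omega
  have h2 := hβs (m - k)
  have h3 := mul_le_mul_of_nonneg_left (hc k) (hβ (m - k))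
  rw [e]
  push_cast [hk'] at h2 h3 ⊢
  rw [h2]
  linarith

/-- The bound passes through the recursion: the convolution adds `b` to the constant, and the
prefactor `Γ(m + a)/Γ(m + a')` is nonincreasing in `m` since `a ≤ a'`. It yields convergence of `G`
on `(0, 1)` and boundedness of `y G'/G`. -/
lemma exists_gammaCoeff_succ_le {n : ℕ} (hn : 0 < n) (j : ℕ) : ∃ C : ℝ, 0 ≤ C ∧ ∀ m : ℕ,
    (m + 1) * gammaCoeff n (j + 1) (m + 1) ≤ (m + C) * gammaCoeff n (j + 1) m := by
  have hn' : (0 : ℝ) < n := by exact_mod_cast hn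
  induction j with
  | zero =>
    refine ⟨0, le_rfl, fun m => ?_⟩
    rcases m with _ | m <;> simp [gammaCoeff]
  | succ j ih =>
    obtain ⟨C, hC, h⟩ := ih
    set b : ℝ := ((j : ℝ) + 2) / n
    have hb : 0 < b := by positivity
    set a : ℝ := ((j : ℝ) + 1) * (j + 2) / (2 * n)
    set a' : ℝ := ((j : ℝ) + 2) * (j + 3) / (2 * n)
    have ha : 0 < a := by positivity
    have haa : a ≤ a' := by
      simp only [a, a']
      gcongr ?_ / _
      nlinarith [(Nat.cast_nonneg j : (0 : ℝ) ≤ j)]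
    have ha' : 0 < a' := ha.trans_le haa
    refine ⟨b + C, by positivity, fun m => ?_⟩
    set s : ℕ → ℝ := fun m => ∑ k ∈ Finset.range (m + 1),
      Real.Gamma (((m - k : ℕ) : ℝ) + b) / ((m - k).factorial : ℝ) * gammaCoeff n (j + 1) k
    have hs : 0 ≤ s m := Finset.sum_nonneg fun k _ =>
      mul_nonneg (by positivity) (gammaCoeff_nonneg hn _ _)
    have hc : ∀ m : ℕ, gammaCoeff n (j + 1 + 1) m =
        Real.Gamma (m + a) / Real.Gamma (m + a') * s m := fun m => by rw [gammaCoeff]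
    have key : (m + 1) * s (m + 1) ≤ (m + (b + C)) * s m := by
      refine add_one_mul_sum_range_le (β := fun j : ℕ => Real.Gamma (j + b) / (j.factorial : ℝ))
        (fun j => by positivity) (fun j => ?_) h m
      simp only [Nat.factorial_succ, Nat.cast_mul, Nat.cast_succ]
      rw [show (j : ℝ) + 1 + b = (j + b) + 1 by ring, Real.Gamma_add_one (by positivity)]
      field_simp
    have hr : Real.Gamma ((m + 1 : ℕ) + a) / Real.Gamma ((m + 1 : ℕ) + a') ≤
        Real.Gamma (m + a) / Real.Gamma (m + a') := by
      push_cast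
      rw [show (m : ℝ) + 1 + a = (m + a) + 1 by ring, show (m : ℝ) + 1 + a' = (m + a') + 1 by ring,
        Real.Gamma_add_one (by positivity), Real.Gamma_add_one (by positivity), mul_div_mul_comm]
      refine mul_le_of_le_one_left (by positivity) ?_
      rw [div_le_one (by positivity)]
      linarith
    rw [hc, hc]
    have hR : 0 ≤ Real.Gamma (m + a) / Real.Gamma (m + a') := by positivity
    have hs1 : 0 ≤ s (m + 1) := Finset.sum_nonneg fun k _ =>
      mul_nonneg (by positivity) (gammaCoeff_nonneg hn _ _)
    calc (m + 1) * (Real.Gamma ((m + 1 : ℕ) + a) / Real.Gamma ((m + 1 : ℕ) + a') * s (m + 1))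
        ≤ (m + 1) * (Real.Gamma (m + a) / Real.Gamma (m + a') * s (m + 1)) := by gcongr
      _ = Real.Gamma (m + a) / Real.Gamma (m + a') * ((m + 1) * s (m + 1)) := by ring
      _ ≤ Real.Gamma (m + a) / Real.Gamma (m + a') * ((m + (b + C)) * s m) := by gcongr
      _ = _ := by ring

/-- The sum that gives the Mellin transform of the density built from the coefficients `γᵢ`. -/
lemma tsum_gammaCoeff_mul_Gamma {n : ℕ} (hn : 0 < n) {α : ℝ} (hα : 0 < α) (j : ℕ) :
    ∑' m : ℕ, ENNReal.ofReal (gammaCoeff n (j + 1) m *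
      (Real.Gamma (m + ((j : ℝ) + 1) * (j + 2) / (2 * n)) /
        Real.Gamma (α + (m + ((j : ℝ) + 1) * (j + 2) / (2 * n))))) =
    ENNReal.ofReal (Real.Gamma α ^ j * ∏ k ∈ Finset.range (j + 1),
      (Real.Gamma (((k : ℝ) + 1) / n) / Real.Gamma (α + ((k : ℝ) + 1) / n))) := by
  have hn' : (0 : ℝ) < n := by exact_mod_cast hn
  have hΓα := Real.Gamma_pos_of_pos hα
  induction j with
  | zero =>
    rw [tsum_eq_single 0 (fun m hm => by simp [gammaCoeff, hm])]
    simp only [gammaCoeff, if_true, pow_zero, one_mul, zero_add, Finset.prod_range_one,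
      Nat.cast_zero]
    rw [show (2 : ℝ) / (2 * n) = 1 / n by field_simp]
  | succ j ih =>
    set b : ℝ := ((j : ℝ) + 2) / n with hb_def
    have hb : 0 < b := by positivity
    set a : ℝ := ((j : ℝ) + 1) * (j + 2) / (2 * n) with ha_def
    have ha : 0 < a := by positivity
    have haa : (((j + 1 : ℕ) : ℝ) + 1) * ((j + 1 : ℕ) + 2) / (2 * n) = a + b := by
      rw [ha_def, hb_def]; push_cast; field_simp; ring
    have haa' : ((j : ℝ) + 2) * (j + 3) / (2 * n) = a + b := by
      rw [ha_def, hb_def]; field_simp; ring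
    rw [haa]
    have hβ : ∀ j : ℕ, 0 ≤ Real.Gamma (j + b) / (j.factorial : ℝ) := fun j => by positivity
    -- The denominator in the recursion cancels against `Γ(m + (a + b))`. After the sums are
    -- interchanged, the inner one is Gauss's sum with `A = k + a`.
    have h1 : ∀ m : ℕ, ENNReal.ofReal (gammaCoeff n (j + 1 + 1) m *
        (Real.Gamma (m + (a + b)) / Real.Gamma (α + (m + (a + b))))) =
        ∑ k ∈ Finset.range (m + 1), ENNReal.ofReal (gammaCoeff n (j + 1) k) *
          ENNReal.ofReal (Real.Gamma ((m - k : ℕ) + b) / ((m - k).factorial : ℝ) *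
            (Real.Gamma ((k + a) + (m - k : ℕ)) /
              Real.Gamma (α + b + ((k + a) + (m - k : ℕ))))) := fun m => by
      rw [gammaCoeff, haa', ← ha_def, ← hb_def, mul_assoc, mul_comm (Finset.sum _ _), ← mul_assoc,
        Finset.mul_sum, ENNReal.ofReal_sum_of_nonneg]
      · refine Finset.sum_congr rfl fun k hk => ?_
        rw [← ENNReal.ofReal_mul (gammaCoeff_nonneg hn _ _)]
        congr 1
        have : (k : ℝ) + a + (m - k : ℕ) = m + a := by
          rw [Nat.cast_sub (Finset.mem_range_succ_iff.1 hk)]; ring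
        rw [this, show α + b + (m + a) = α + (m + (a + b)) by ring]
        have : Real.Gamma (m + (a + b)) ≠ 0 := (Real.Gamma_pos_of_pos (by positivity)).ne'
        field_simp
      · intro k _
        have := gammaCoeff_nonneg hn (j + 1) k
        positivity
    rw [tsum_congr h1, tsum_sum_range_eq_tsum_tsum (fun k i => ENNReal.ofReal
      (gammaCoeff n (j + 1) k) * ENNReal.ofReal (Real.Gamma (i + b) / (i.factorial : ℝ) *
        (Real.Gamma ((k + a) + i) / Real.Gamma (α + b + ((k + a) + i)))))]
    have h2 : ∀ k : ℕ, ∑' i : ℕ, ENNReal.ofReal (gammaCoeff n (j + 1) k) *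
        ENNReal.ofReal (Real.Gamma (i + b) / (i.factorial : ℝ) *
          (Real.Gamma ((k + a) + i) / Real.Gamma (α + b + ((k + a) + i)))) =
        ENNReal.ofReal (Real.Gamma b * Real.Gamma α / Real.Gamma (α + b)) *
        ENNReal.ofReal (gammaCoeff n (j + 1) k *
          (Real.Gamma (k + a) / Real.Gamma (α + (k + a)))) := fun k => by
      rw [ENNReal.tsum_mul_left, tsum_Gamma_eq (by positivity) hb hα,
        ENNReal.ofReal_mul (by positivity), ENNReal.ofReal_mul (gammaCoeff_nonneg hn _ _)]
      ring
    rw [tsum_congr h2, ENNReal.tsum_mul_left, ih, ← ENNReal.ofReal_mul (by positivity)]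
    congr 1
    rw [Finset.prod_range_succ _ (j + 1), pow_succ]
    have : ((j + 1 : ℕ) : ℝ) + 1 = j + 2 := by push_cast; ring
    rw [this, ← hb_def]
    ring

/-! ### Power series in `1 - y` with controlled coefficient ratios. -/

section PowerSeries

variable {c : ℕ → ℝ} {C : ℝ}

/-- Ratio test. The factor `m`, rather than `m + 1`, lets the same criterion serve both `c m` and `m
* c m`. -/
lemma summable_of_succ_le {d : ℕ → ℝ} {D x : ℝ} (hd : ∀ m, 0 ≤ d m)
    (h : ∀ m : ℕ, 1 ≤ m → m * d (m + 1) ≤ (m + D) * d m) (hx0 : 0 ≤ x) (hx : x < 1) :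
    Summable fun m => d m * x ^ m := by
  have hlim : Filter.Tendsto (fun m : ℕ => (1 + D / m) * x) Filter.atTop (𝓝 x) := by
    simpa using ((tendsto_const_div_atTop_nhds_zero_nat D).const_add 1).mul_const x
  obtain ⟨r, hxr, hr⟩ := exists_between hx
  refine summable_of_ratio_norm_eventually_le hr ?_
  filter_upwards [hlim.eventually_le_const hxr, Filter.eventually_ge_atTop 1] with m hm hm1
  rw [Real.norm_of_nonneg (mul_nonneg (hd _) (by positivity)),
    Real.norm_of_nonneg (mul_nonneg (hd _) (by positivity))]
  have hm0 : (0 : ℝ) < m := by exact_mod_cast hm1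
  have h1 : d (m + 1) ≤ (1 + D / m) * d m := by
    have := h m hm1
    rw [one_add_div hm0.ne', div_mul_eq_mul_div, le_div_iff₀ hm0]
    linarith
  calc d (m + 1) * x ^ (m + 1) ≤ (1 + D / m) * d m * x ^ (m + 1) := by gcongr
    _ = (1 + D / m) * x * (d m * x ^ m) := by ring
    _ ≤ r * (d m * x ^ m) := by
        have := hd m
        gcongr

lemma summable_mul_pow (hc : ∀ m, 0 ≤ c m)
    (h : ∀ m : ℕ, (m + 1) * c (m + 1) ≤ (m + C) * c m) {x : ℝ} (hx0 : 0 ≤ x) (hx : x < 1) :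
    Summable fun m => c m * x ^ m :=
  summable_of_succ_le (D := C) hc (fun m _ => by nlinarith [h m, hc (m + 1)]) hx0 hx

lemma summable_succ_mul_pow (hc : ∀ m, 0 ≤ c m)
    (h : ∀ m : ℕ, (m + 1) * c (m + 1) ≤ (m + C) * c m) {x : ℝ} (hx0 : 0 ≤ x) (hx : x < 1) :
    Summable fun m : ℕ => (m + 1) * c (m + 1) * x ^ m := by
  have := (summable_of_succ_le (d := fun m => m * c m) (D := C) (x := x)
    (fun m => mul_nonneg (by positivity) (hc m)) (fun m _ => ?_) hx0 hx)
  · refine Summable.of_nonneg_of_le (fun m => mul_nonneg (mul_nonneg (by positivity) (hc _))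
      (by positivity)) (fun m => ?_) (this.add ((summable_mul_pow hc h hx0 hx).mul_left C))
    have := mul_le_mul_of_nonneg_right (h m) (pow_nonneg hx0 m)
    linarith
  · have := mul_le_mul_of_nonneg_left (h m) (Nat.cast_nonneg (α := ℝ) m)
    push_cast
    linarith

lemma hasDerivAt_tsum_one_sub_pow (hc : ∀ m, 0 ≤ c m)
    (h : ∀ m : ℕ, (m + 1) * c (m + 1) ≤ (m + C) * c m) {y : ℝ} (hy0 : 0 < y) (hy1 : y < 1) :
    HasDerivAt (fun y => ∑' m, c m * (1 - y) ^ m)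
      (-∑' m : ℕ, (m + 1) * c (m + 1) * (1 - y) ^ m) y := by
  have hd : ∀ (m : ℕ) (z : ℝ), HasDerivAt (fun z => c m * (1 - z) ^ m)
      (-(m * c m * (1 - z) ^ (m - 1))) z := fun m z => by
    have := (((hasDerivAt_id z).const_sub 1).pow m).const_mul (c m)
    refine this.congr_deriv ?_
    simp only [id]
    ring
  have hr0 : 0 ≤ 1 - y / 2 := by linarith
  have hr1 : 1 - y / 2 < 1 := by linarith
  have hsum : Summable fun m : ℕ => m * c m * (1 - y / 2) ^ (m - 1) := by
    rw [← summable_nat_add_iff 1]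
    simpa using summable_succ_mul_pow hc h hr0 hr1
  -- On `(y/2, 1)` one has `1 - z ≤ 1 - y/2 < 1`, which gives a summable majorant of the
  -- derivatives.
  have key := hasDerivAt_tsum_of_isPreconnected (t := Ioo (y / 2) 1) (y₀ := y) (y := y) hsum
    isOpen_Ioo isPreconnected_Ioo (fun m z _ => hd m z) (fun m z hz => ?_)
    ⟨by linarith, hy1⟩ (summable_mul_pow hc h (by linarith) (by linarith)) ⟨by linarith, hy1⟩
  · refine key.congr_deriv ?_
    rw [tsum_neg, Summable.tsum_eq_zero_add]
    · simp
    · rw [← summable_nat_add_iff 1]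
      simpa using summable_succ_mul_pow hc h (x := 1 - y) (by linarith) (by linarith)
  · have hz0 : 0 ≤ 1 - z := by linarith [hz.2]
    have hcm := hc m
    rw [norm_neg, Real.norm_of_nonneg (by positivity)]
    gcongr
    exact hz.1.le

/-- With `x = 1 - y` this is `(1 - x) g'(x) ≤ C g(x)`, the coefficient inequality multiplied by
`x^m` and summed. -/
lemma mul_tsum_succ_le (hc : ∀ m, 0 ≤ c m)
    (h : ∀ m : ℕ, (m + 1) * c (m + 1) ≤ (m + C) * c m) {y : ℝ} (hy0 : 0 < y) (hy1 : y < 1) :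
    y * ∑' m : ℕ, (m + 1) * c (m + 1) * (1 - y) ^ m ≤ C * ∑' m, c m * (1 - y) ^ m := by
  have hx0 : 0 ≤ 1 - y := by linarith
  have hx : 1 - y < 1 := by linarith
  have s1 := summable_succ_mul_pow hc h hx0 hx
  have s0 := summable_mul_pow hc h hx0 hx
  have s2 : Summable fun m : ℕ => m * c m * (1 - y) ^ m := by
    rw [← summable_nat_add_iff 1]
    simpa [pow_succ, mul_assoc] using s1.mul_right (1 - y)
  have e : (1 - y) * ∑' m : ℕ, (m + 1) * c (m + 1) * (1 - y) ^ m =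
      ∑' m : ℕ, m * c m * (1 - y) ^ m := by
    rw [s2.tsum_eq_zero_add, ← tsum_mul_left]
    simp only [Nat.cast_zero, zero_mul, zero_add, Nat.cast_succ, pow_succ]
    exact tsum_congr fun m => by ring
  have e2 : ∑' m : ℕ, (m + 1) * c (m + 1) * (1 - y) ^ m ≤
      ∑' m : ℕ, (m * c m * (1 - y) ^ m + C * (c m * (1 - y) ^ m)) :=
    s1.tsum_le_tsum (fun m => by nlinarith [mul_le_mul_of_nonneg_right (h m) (pow_nonneg hx0 m)])
      (s2.add (s0.mul_left C))
  rw [s2.tsum_add (s0.mul_left C), tsum_mul_left, ← e] at e2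
  linarith

end PowerSeries

/-! ### The exponential family of sample laws. -/

/-- The statistic `log X₁ + ⋯ + log Xₙ`. -/
noncomputable def logSum {n : ℕ} (x : Fin n → ℝ) : ℝ := ∑ i, Real.log (x i)

@[fun_prop]
lemma measurable_logSum {n : ℕ} : Measurable (logSum (n := n)) := by unfold logSum; fun_prop

@[fun_prop]
lemma measurable_statX {n : ℕ} : Measurable (statX (n := n)) := by unfold statX; fun_prop

@[fun_prop]
lemma measurable_statY {n : ℕ} : Measurable (statY (n := n)) := by unfold statY; fun_prop

/-- The normalizing factor of the density of one Gamma distribution with respect to another. -/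
noncomputable def tiltConst (a r a' r' : ℝ) : ℝ :=
  r' ^ a' / Real.Gamma a' * (Real.Gamma a / r ^ a)

lemma tiltConst_pos {a r a' r' : ℝ} (ha : 0 < a) (hr : 0 < r) (ha' : 0 < a') (hr' : 0 < r') :
    0 < tiltConst a r a' r' := by unfold tiltConst; positivity

lemma ae_pos_gammaMeasure (a r : ℝ) : ∀ᵐ x ∂(gammaMeasure a r), 0 < x := by
  rw [gammaMeasure, ae_withDensity_iff (by unfold gammaPDF; fun_prop)]
  have : ∀ᵐ x : ℝ, x ≠ 0 := Measure.ae_ne volume 0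
  filter_upwards [this] with x hx h
  rcases lt_or_gt_of_ne hx with h' | h'
  · exact absurd (gammaPDF_of_neg h') h
  · exact h'

/-- Any two Gamma laws differ by an exponential tilt in `log x` and `x`. Both densities vanish for
`x < 0`, and `0` is a null set. -/
lemma gammaMeasure_eq_withDensity {a r a' r' : ℝ} (ha : 0 < a) (hr : 0 < r) (ha' : 0 < a')
    (hr' : 0 < r') :
    gammaMeasure a' r' = (gammaMeasure a r).withDensity fun x =>
      ENNReal.ofReal (tiltConst a r a' r' * Real.exp ((a' - a) * Real.log x + (r - r') * x)) := by
  have hm : Measurable fun x => ENNReal.ofReal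
      (tiltConst a r a' r' * Real.exp ((a' - a) * Real.log x + (r - r') * x)) := by fun_prop
  have hg : Measurable (gammaPDF a r) := by unfold gammaPDF; fun_prop
  rw [gammaMeasure, gammaMeasure, ← withDensity_mul _ hg hm]
  refine withDensity_congr_ae ?_
  filter_upwards [Measure.ae_ne volume (0 : ℝ)] with x hx
  rcases lt_or_gt_of_ne hx with h | h
  · simp [gammaPDF_of_neg h]
  · have hΓ := Real.Gamma_pos_of_pos ha
    have hΓ' := Real.Gamma_pos_of_pos ha'
    rw [Pi.mul_apply, gammaPDF_of_nonneg h.le, gammaPDF_of_nonneg h.le,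
      ← ENNReal.ofReal_mul (by positivity)]
    congr 1
    rw [tiltConst, Real.exp_add, mul_comm (a' - a), ← Real.rpow_def_of_pos h,
      show a' - 1 = (a - 1) + (a' - a) by ring, Real.rpow_add h,
      show -(r' * x) = -(r * x) + (r - r') * x by ring, Real.exp_add]
    have := (Real.rpow_pos_of_pos hr a).ne'
    field_simp

lemma lintegral_pi_prod {ι : Type*} [Fintype ι] {Ω : ι → Type*} {mΩ : ∀ i, MeasurableSpace (Ω i)}
    (μ : ∀ i, Measure (Ω i)) [∀ i, IsProbabilityMeasure (μ i)] {f : ∀ i, Ω i → ℝ≥0∞}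
    (hf : ∀ i, Measurable (f i)) :
    ∫⁻ x, ∏ i, f i (x i) ∂(Measure.pi μ) = ∏ i, ∫⁻ x, f i x ∂(μ i) := by
  rw [lintegral_prod_eq_prod_lintegral_of_indepFun Finset.univ
    (fun i (x : ∀ i, Ω i) => f i (x i))
    (iIndepFun_pi fun i => (hf i).aemeasurable)
    (fun i => (hf i).comp (measurable_pi_apply i))]
  refine Finset.prod_congr rfl fun i _ => ?_
  exact (measurePreserving_eval μ i).lintegral_comp (hf i)

lemma pi_withDensity {ι : Type*} [Fintype ι] {Ω : ι → Type*} {mΩ : ∀ i, MeasurableSpace (Ω i)}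
    (μ : ∀ i, Measure (Ω i)) [∀ i, IsProbabilityMeasure (μ i)] {f : ∀ i, Ω i → ℝ≥0∞}
    (hf : ∀ i, Measurable (f i)) [∀ i, SigmaFinite ((μ i).withDensity (f i))] :
    Measure.pi (fun i => (μ i).withDensity (f i)) =
      (Measure.pi μ).withDensity fun x => ∏ i, f i (x i) := by
  refine Measure.pi_eq fun s hs => ?_
  rw [withDensity_apply _ (MeasurableSet.univ_pi hs),
    ← lintegral_indicator (MeasurableSet.univ_pi hs)]
  have : ∀ x : ∀ i, Ω i, (univ.pi s).indicator (fun x => ∏ i, f i (x i)) x =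
      ∏ i, (s i).indicator (f i) (x i) := fun x => by
    by_cases hx : x ∈ univ.pi s
    · rw [indicator_of_mem hx]
      exact Finset.prod_congr rfl fun i _ => (indicator_of_mem (hx i (mem_univ i)) _).symm
    · rw [indicator_of_notMem hx]
      simp only [mem_univ_pi, not_forall] at hx
      obtain ⟨i, hi⟩ := hx
      exact (Finset.prod_eq_zero (Finset.mem_univ i) (indicator_of_notMem hi _)).symm
  simp only [this]
  rw [lintegral_pi_prod μ fun i => (hf i).indicator (hs i)]
  refine Finset.prod_congr rfl fun i _ => ?_
  rw [lintegral_indicator (hs i), withDensity_apply _ (hs i)]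

lemma isProbabilityMeasure_law (n : ℕ) {α lam : ℝ} (hα : 0 < α) (hl : 0 < lam) :
    IsProbabilityMeasure (law n (α, lam)) := by
  have := isProbabilityMeasure_gammaMeasure hα hl
  unfold law
  infer_instance

lemma ae_pos_law (n : ℕ) {α lam : ℝ} (hα : 0 < α) (hl : 0 < lam) :
    ∀ᵐ x ∂(law n (α, lam)), ∀ i, 0 < x i := by
  have := isProbabilityMeasure_gammaMeasure hα hl
  rw [ae_all_iff]
  intro i
  exact (measurePreserving_eval (fun _ : Fin n => gammaMeasure α lam) i).quasiMeasurePreserving.ae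
    (ae_pos_gammaMeasure α lam)

lemma law_eq_withDensity (n : ℕ) {a r a' r' : ℝ} (ha : 0 < a) (hr : 0 < r) (ha' : 0 < a')
    (hr' : 0 < r') :
    law n (a', r') = (law n (a, r)).withDensity fun x => ENNReal.ofReal
      (tiltConst a r a' r' ^ n * Real.exp ((a' - a) * logSum x + (r - r') * statX x)) := by
  have := isProbabilityMeasure_gammaMeasure ha hr
  have := isProbabilityMeasure_gammaMeasure ha' hr'
  have hK := tiltConst_pos ha hr ha' hr'
  have e := gammaMeasure_eq_withDensity ha hr ha' hr'
  have : SigmaFinite ((gammaMeasure a r).withDensity fun x => ENNReal.ofReal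
      (tiltConst a r a' r' * Real.exp ((a' - a) * Real.log x + (r - r') * x))) := by
    rw [← e]; infer_instance
  simp only [law]
  rw [e, pi_withDensity _ (fun i => by fun_prop)]
  congr 1
  ext x
  rw [← ENNReal.ofReal_prod_of_nonneg (fun i _ => by positivity), Finset.prod_mul_distrib,
    ← Real.exp_sum, Finset.prod_const, Finset.card_univ, Fintype.card_fin,
    Finset.sum_add_distrib, ← Finset.mul_sum, ← Finset.mul_sum]
  rfl

lemma law_absolutelyContinuous (n : ℕ) {a r a' r' : ℝ} (ha : 0 < a) (hr : 0 < r) (ha' : 0 < a')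
    (hr' : 0 < r') : law n (a', r') ≪ law n (a, r) := by
  rw [law_eq_withDensity n ha hr ha' hr']
  exact withDensity_absolutelyContinuous _ _

/-- Integrals with respect to one law of the family in terms of another one. -/
lemma integrable_law_iff_and_integral_law_eq (n : ℕ) {a r a' r' : ℝ} (ha : 0 < a) (hr : 0 < r)
    (ha' : 0 < a') (hr' : 0 < r') (T : (Fin n → ℝ) → ℝ) :
    (Integrable T (law n (a', r')) ↔ Integrable
      (fun x => T x * Real.exp ((a' - a) * logSum x + (r - r') * statX x)) (law n (a, r))) ∧
    ∫ x, T x ∂(law n (a', r')) = tiltConst a r a' r' ^ n *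
      ∫ x, T x * Real.exp ((a' - a) * logSum x + (r - r') * statX x) ∂(law n (a, r)) := by
  have hK := tiltConst_pos ha hr ha' hr'
  have hK' : tiltConst a r a' r' ^ n ≠ 0 := by positivity
  have hm : Measurable fun x : Fin n → ℝ => ENNReal.ofReal
      (tiltConst a r a' r' ^ n * Real.exp ((a' - a) * logSum x + (r - r') * statX x)) := by fun_prop
  have hfin : ∀ᵐ x ∂(law n (a, r)), ENNReal.ofReal
      (tiltConst a r a' r' ^ n * Real.exp ((a' - a) * logSum x + (r - r') * statX x)) < ∞ := by
    simp
  have e : ∀ x : Fin n → ℝ, (ENNReal.ofReal (tiltConst a r a' r' ^ n *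
      Real.exp ((a' - a) * logSum x + (r - r') * statX x))).toReal • T x =
      tiltConst a r a' r' ^ n *
        (T x * Real.exp ((a' - a) * logSum x + (r - r') * statX x)) := fun x => by
    rw [ENNReal.toReal_ofReal (by positivity), smul_eq_mul]; ring
  rw [law_eq_withDensity n ha hr ha' hr', integrable_withDensity_iff_integrable_smul' hm hfin,
    integral_withDensity_eq_integral_toReal_smul hm hfin]
  simp only [e]
  rw [integrable_const_mul_iff (by simpa using hK'), integral_const_mul]
  exact ⟨Iff.rfl, rfl⟩

/-! ### The distribution of `Y` and its Mellin transform. -/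

/-- The density of `Y`, up to the factor `y ^ (α - 1)` and a normalizing constant. -/
noncomputable def kernelY (n : ℕ) (y : ℝ) : ℝ := (1 - y) ^ (((n : ℝ) - 3) / 2) * G n y

/-- The Mellin transform of `kernelY`. -/
noncomputable def mellinY (n : ℕ) (α : ℝ) : ℝ :=
  Real.Gamma α ^ (n - 1) * ∏ k ∈ Finset.range (n - 1),
    (Real.Gamma (((k : ℝ) + 1) / n) / Real.Gamma (α + ((k : ℝ) + 1) / n))

/-- The law of `Y`. -/
noncomputable def measureY (n : ℕ) (α : ℝ) : Measure ℝ :=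
  (volume.restrict (Ioo 0 1)).withDensity fun y =>
    ENNReal.ofReal (y ^ (α - 1) * kernelY n y / mellinY n α)

/-- The series of `-G'`. -/
noncomputable def derivSeries (n : ℕ) (y : ℝ) : ℝ :=
  ∑' m : ℕ, ((m : ℝ) + 1) * gammaCoeff n (n - 1) (m + 1) * (1 - y) ^ m

lemma mellinY_pos {n : ℕ} (hn : 2 ≤ n) {α : ℝ} (hα : 0 < α) : 0 < mellinY n α := by
  have hn' : (0 : ℝ) < n := by exact_mod_cast (by omega : 0 < n)
  have := Real.Gamma_pos_of_pos hα
  refine mul_pos (by positivity) (Finset.prod_pos fun k _ => ?_)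
  positivity

lemma exists_gammaCoeff_sub_one_succ_le {n : ℕ} (hn : 2 ≤ n) : ∃ C : ℝ, 0 ≤ C ∧ ∀ m : ℕ,
    ((m : ℝ) + 1) * gammaCoeff n (n - 1) (m + 1) ≤ (m + C) * gammaCoeff n (n - 1) m := by
  have := exists_gammaCoeff_succ_le (n := n) (by omega) (n - 2)
  rwa [show n - 2 + 1 = n - 1 by omega] at this

lemma gammaCoeff_sub_one_nonneg {n : ℕ} (hn : 2 ≤ n) (m : ℕ) : 0 ≤ gammaCoeff n (n - 1) m :=
  gammaCoeff_nonneg (by omega) _ _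

lemma summable_G {n : ℕ} (hn : 2 ≤ n) {y : ℝ} (hy : y ∈ Ioo (0 : ℝ) 1) :
    Summable fun m => gammaCoeff n (n - 1) m * (1 - y) ^ m := by
  obtain ⟨C, -, h⟩ := exists_gammaCoeff_sub_one_succ_le hn
  exact summable_mul_pow (gammaCoeff_sub_one_nonneg hn) h (by linarith [hy.2]) (by linarith [hy.1])

lemma summable_derivSeries {n : ℕ} (hn : 2 ≤ n) {y : ℝ} (hy : y ∈ Ioo (0 : ℝ) 1) :
    Summable fun m : ℕ => ((m : ℝ) + 1) * gammaCoeff n (n - 1) (m + 1) * (1 - y) ^ m := by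
  obtain ⟨C, -, h⟩ := exists_gammaCoeff_sub_one_succ_le hn
  exact summable_succ_mul_pow (gammaCoeff_sub_one_nonneg hn) h (by linarith [hy.2])
    (by linarith [hy.1])

lemma gammaCoeff_le_G {n : ℕ} (hn : 2 ≤ n) {y : ℝ} (hy : y ∈ Ioo (0 : ℝ) 1) :
    gammaCoeff n (n - 1) 0 ≤ G n y := by
  have := (summable_G hn hy).le_tsum 0 fun m _ =>
    mul_nonneg (gammaCoeff_sub_one_nonneg hn m) (pow_nonneg (by linarith [hy.2]) m)
  simpa [G] using this

lemma gammaCoeff_sub_one_zero_pos {n : ℕ} (hn : 2 ≤ n) : 0 < gammaCoeff n (n - 1) 0 := by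
  have := gammaCoeff_zero_pos (n := n) (by omega) (n - 2)
  rwa [show n - 2 + 1 = n - 1 by omega] at this

lemma G_pos {n : ℕ} (hn : 2 ≤ n) {y : ℝ} (hy : y ∈ Ioo (0 : ℝ) 1) : 0 < G n y :=
  (gammaCoeff_sub_one_zero_pos hn).trans_le (gammaCoeff_le_G hn hy)

lemma kernelY_pos {n : ℕ} (hn : 2 ≤ n) {y : ℝ} (hy : y ∈ Ioo (0 : ℝ) 1) : 0 < kernelY n y :=
  mul_pos (Real.rpow_pos_of_pos (by linarith [hy.2]) _) (G_pos hn hy)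

lemma derivSeries_nonneg {n : ℕ} (hn : 2 ≤ n) {y : ℝ} (hy : y ∈ Ioo (0 : ℝ) 1) :
    0 ≤ derivSeries n y :=
  tsum_nonneg fun m => mul_nonneg (mul_nonneg (by positivity) (gammaCoeff_sub_one_nonneg hn _))
    (pow_nonneg (by linarith [hy.2]) m)

lemma deriv_G {n : ℕ} (hn : 2 ≤ n) {y : ℝ} (hy : y ∈ Ioo (0 : ℝ) 1) :
    deriv (G n) y = -derivSeries n y := by
  obtain ⟨C, -, h⟩ := exists_gammaCoeff_sub_one_succ_le hn
  exact (hasDerivAt_tsum_one_sub_pow (gammaCoeff_sub_one_nonneg hn) h hy.1 hy.2).deriv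

lemma u₀_eq {n : ℕ} (hn : 2 ≤ n) {y : ℝ} (hy : y ∈ Ioo (0 : ℝ) 1) :
    u₀ n y = ((n : ℝ) - 3) / 2 * (y / (1 - y)) + y * derivSeries n y / G n y := by
  rw [u₀, deriv_G hn hy]
  ring

lemma exists_u₀_le {n : ℕ} (hn : 2 ≤ n) : ∃ C : ℝ, 0 ≤ C ∧ ∀ y ∈ Ioo (0 : ℝ) 1,
    u₀ n y ≤ ((n : ℝ) - 3) / 2 * (y / (1 - y)) + C := by
  obtain ⟨C, hC, h⟩ := exists_gammaCoeff_sub_one_succ_le hn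
  refine ⟨C, hC, fun y hy => ?_⟩
  rw [u₀_eq hn hy]
  gcongr
  rw [div_le_iff₀ (G_pos hn hy)]
  exact mul_tsum_succ_le (gammaCoeff_sub_one_nonneg hn) h hy.1 hy.2

lemma le_u₀ {n : ℕ} (hn : 2 ≤ n) {y : ℝ} (hy : y ∈ Ioo (0 : ℝ) 1) :
    ((n : ℝ) - 3) / 2 * (y / (1 - y)) ≤ u₀ n y := by
  rw [u₀_eq hn hy]
  have := derivSeries_nonneg hn hy
  have := G_pos hn hy
  have := hy.1
  exact le_add_of_nonneg_right (by positivity)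

/-- On `(-∞, 1]` the function `G` is given by a sum of nonnegative terms. -/
lemma exists_measurable_eq_G {n : ℕ} (hn : 2 ≤ n) :
    ∃ H : ℝ → ℝ, Measurable H ∧ ∀ y ≤ 1, G n y = H y := by
  refine ⟨fun y => (∑' m : ℕ, ENNReal.ofReal (gammaCoeff n (n - 1) m * (1 - y) ^ m)).toReal,
    (Measurable.tsum fun m => by fun_prop).ennreal_toReal, fun y hy => ?_⟩
  simp only [G]
  rw [ENNReal.tsum_toReal_eq (by simp)]
  refine tsum_congr fun m => ?_
  rw [ENNReal.toReal_ofReal]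
  exact mul_nonneg (gammaCoeff_sub_one_nonneg hn m) (pow_nonneg (by linarith) m)

lemma exists_measurable_eq_u₀ {n : ℕ} (hn : 2 ≤ n) :
    ∃ v : ℝ → ℝ, Measurable v ∧ ∀ y ≤ 1, u₀ n y = v y := by
  obtain ⟨H, hH, e⟩ := exists_measurable_eq_G hn
  refine ⟨fun y => ((n : ℝ) - 3) / 2 * (y / (1 - y)) - y * deriv (G n) y / H y, ?_,
    fun y hy => by rw [u₀, e y hy]⟩
  have := measurable_deriv (G n)
  fun_prop

lemma aemeasurable_kernelY {n : ℕ} (hn : 2 ≤ n) :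
    AEMeasurable (kernelY n) (volume.restrict (Ioo 0 1)) := by
  obtain ⟨H, hH, e⟩ := exists_measurable_eq_G hn
  refine ⟨fun y => (1 - y) ^ (((n : ℝ) - 3) / 2) * H y, by fun_prop, ?_⟩
  filter_upwards [ae_restrict_mem measurableSet_Ioo] with y hy
  rw [kernelY, e y hy.2.le]

/-- Tonelli and Beta integrals. The pairs `(p, q)` used below are `(α, (n-1)/2)` for the density,
`(α+1, (n-3)/2)` for `u₀` and `(α+2, (n-5)/2)` for the square of `y/(1-y)`. -/
lemma lintegral_tsum_rpow_mul {d : ℕ → ℝ} (hd : ∀ m, 0 ≤ d m) {p q : ℝ} (hp : 0 < p)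
    (hq : 0 < q) :
    ∫⁻ y in Ioo (0 : ℝ) 1, ∑' m : ℕ,
        ENNReal.ofReal (d m * (y ^ (p - 1) * (1 - y) ^ (q + m - 1))) =
      ∑' m : ℕ, ENNReal.ofReal (d m * (Real.Gamma p * Real.Gamma (q + m) /
        Real.Gamma (p + (q + m)))) := by
  rw [lintegral_tsum (fun m => by fun_prop)]
  refine tsum_congr fun m => ?_
  simp only [ENNReal.ofReal_mul (hd m)]
  rw [lintegral_const_mul _ (by fun_prop), lintegral_rpow_mul_one_sub_rpow hp (by positivity)]

lemma tsum_gammaCoeff_eq_mellinY {n : ℕ} (hn : 2 ≤ n) {α : ℝ} (hα : 0 < α) :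
    ∑' m : ℕ, ENNReal.ofReal (gammaCoeff n (n - 1) m * (Real.Gamma α *
      Real.Gamma (((n : ℝ) - 1) / 2 + m) / Real.Gamma (α + (((n : ℝ) - 1) / 2 + m)))) =
    ENNReal.ofReal (mellinY n α) := by
  have hn' : (0 : ℝ) < n := by exact_mod_cast (by omega : 0 < n)
  have h := tsum_gammaCoeff_mul_Gamma (n := n) (by omega) hα (n - 2)
  have e : (((n - 2 : ℕ) : ℝ) + 1) * ((n - 2 : ℕ) + 2) / (2 * n) = ((n : ℝ) - 1) / 2 := by
    rw [Nat.cast_sub hn]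
    push_cast
    field_simp
    ring
  have hΓ := Real.Gamma_pos_of_pos hα
  rw [e, show n - 2 + 1 = n - 1 by omega] at h
  have h2 : ∀ m : ℕ, ENNReal.ofReal (gammaCoeff n (n - 1) m * (Real.Gamma α *
      Real.Gamma (((n : ℝ) - 1) / 2 + m) / Real.Gamma (α + (((n : ℝ) - 1) / 2 + m)))) =
      ENNReal.ofReal (Real.Gamma α) * ENNReal.ofReal (gammaCoeff n (n - 1) m *
        (Real.Gamma (m + ((n : ℝ) - 1) / 2) / Real.Gamma (α + (m + ((n : ℝ) - 1) / 2)))) := by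
    intro m
    rw [← ENNReal.ofReal_mul hΓ.le, add_comm (((n : ℝ) - 1) / 2)]
    congr 1
    ring
  rw [tsum_congr h2, ENNReal.tsum_mul_left, h, ← ENNReal.ofReal_mul hΓ.le, ← mul_assoc,
    ← pow_succ', show n - 2 + 1 = n - 1 by omega]
  rfl

lemma lintegral_kernelY {n : ℕ} (hn : 2 ≤ n) {α : ℝ} (hα : 0 < α) :
    ∫⁻ y in Ioo (0 : ℝ) 1, ENNReal.ofReal (y ^ (α - 1) * kernelY n y) =
      ENNReal.ofReal (mellinY n α) := by
  have hn' : (2 : ℝ) ≤ n := by exact_mod_cast hn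
  rw [← tsum_gammaCoeff_eq_mellinY hn hα, ← lintegral_tsum_rpow_mul
    (gammaCoeff_sub_one_nonneg hn) hα (by linarith)]
  refine setLIntegral_congr_fun measurableSet_Ioo fun y hy => ?_
  have hx : 0 < 1 - y := by linarith [hy.2]
  have hy0 := hy.1
  have e : ∀ m : ℕ, gammaCoeff n (n - 1) m * (y ^ (α - 1) * (1 - y) ^ (((n : ℝ) - 1) / 2 + m - 1)) =
      y ^ (α - 1) * (1 - y) ^ (((n : ℝ) - 3) / 2) *
        (gammaCoeff n (n - 1) m * (1 - y) ^ m) := fun m => by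
    rw [show ((n : ℝ) - 1) / 2 + m - 1 = ((n : ℝ) - 3) / 2 + m by ring, Real.rpow_add hx,
      Real.rpow_natCast]
    ring
  simp only [e]
  rw [← ENNReal.ofReal_tsum_of_nonneg, tsum_mul_left, kernelY, G, mul_assoc]
  · intro m
    have := gammaCoeff_sub_one_nonneg hn m
    positivity
  · exact (summable_G hn hy).mul_left _

/-- Integration by parts, since `kernelY * u₀ = -y * kernelY'`. It is carried out term by term
through `Γ(α + 1) = α Γ(α)` and `Γ(q + 1) = q Γ(q)`; `n ≥ 4` makes the exponent `(n - 3)/2`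
positive. -/
lemma lintegral_kernelY_mul_u₀ {n : ℕ} (hn : 2 ≤ n) (h4 : 4 ≤ n) {α : ℝ} (hα : 0 < α) :
    ∫⁻ y in Ioo (0 : ℝ) 1, ENNReal.ofReal (y ^ (α - 1) * kernelY n y * u₀ n y) =
      ENNReal.ofReal (α * mellinY n α) := by
  have hn' : (4 : ℝ) ≤ n := by exact_mod_cast h4
  have hd : ∀ m : ℕ, 0 ≤ gammaCoeff n (n - 1) m * (((n : ℝ) - 3) / 2 + m) := fun m =>
    mul_nonneg (gammaCoeff_sub_one_nonneg hn m) (by have := Nat.cast_nonneg (α := ℝ) m; linarith)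
  have h1 := lintegral_tsum_rpow_mul hd (p := α + 1) (q := ((n : ℝ) - 3) / 2) (by positivity)
    (by linarith)
  have h2 : ∀ m : ℕ, ENNReal.ofReal (gammaCoeff n (n - 1) m * (((n : ℝ) - 3) / 2 + m) *
      (Real.Gamma (α + 1) * Real.Gamma (((n : ℝ) - 3) / 2 + m) /
        Real.Gamma (α + 1 + (((n : ℝ) - 3) / 2 + m)))) =
      ENNReal.ofReal α * ENNReal.ofReal (gammaCoeff n (n - 1) m * (Real.Gamma α *
      Real.Gamma (((n : ℝ) - 1) / 2 + m) / Real.Gamma (α + (((n : ℝ) - 1) / 2 + m)))) :=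
    fun m => by
    have hq : ((n : ℝ) - 3) / 2 + m ≠ 0 := by
      have := Nat.cast_nonneg (α := ℝ) m; exact (by linarith : 0 < ((n : ℝ) - 3) / 2 + m).ne'
    rw [← ENNReal.ofReal_mul hα.le, show ((n : ℝ) - 1) / 2 + m = ((n : ℝ) - 3) / 2 + m + 1 by ring,
      Real.Gamma_add_one hα.ne', Real.Gamma_add_one hq,
      show α + 1 + (((n : ℝ) - 3) / 2 + m) = α + (((n : ℝ) - 3) / 2 + m + 1) by ring]
    congr 1
    ring
  rw [tsum_congr h2, ENNReal.tsum_mul_left, tsum_gammaCoeff_eq_mellinY hn hα,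
    ← ENNReal.ofReal_mul hα.le] at h1
  rw [← h1]
  refine setLIntegral_congr_fun measurableSet_Ioo fun y hy => ?_
  have hx : 0 < 1 - y := by linarith [hy.2]
  have hy0 := hy.1
  have e : ∀ m : ℕ, gammaCoeff n (n - 1) m * (((n : ℝ) - 3) / 2 + m) *
      (y ^ (α + 1 - 1) * (1 - y) ^ (((n : ℝ) - 3) / 2 + m - 1)) =
      y ^ α * (1 - y) ^ (((n : ℝ) - 3) / 2) / (1 - y) *
        (((n : ℝ) - 3) / 2 * (gammaCoeff n (n - 1) m * (1 - y) ^ m) +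
          m * gammaCoeff n (n - 1) m * (1 - y) ^ m) := fun m => by
    rw [Real.rpow_sub_one hx.ne', Real.rpow_add hx, Real.rpow_natCast, add_sub_cancel_right]
    ring
  have s1 := (summable_G hn hy).mul_left (((n : ℝ) - 3) / 2)
  have s2 : Summable fun m : ℕ => m * gammaCoeff n (n - 1) m * (1 - y) ^ m := by
    rw [← summable_nat_add_iff 1]
    simpa [pow_succ, mul_assoc] using (summable_derivSeries hn hy).mul_right (1 - y)
  have e2 : ∑' m : ℕ, m * gammaCoeff n (n - 1) m * (1 - y) ^ m = (1 - y) * derivSeries n y := by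
    rw [s2.tsum_eq_zero_add, derivSeries, ← tsum_mul_left]
    simp only [Nat.cast_zero, zero_mul, zero_add, Nat.cast_succ, pow_succ]
    exact tsum_congr fun m => by ring
  rw [← ENNReal.ofReal_tsum_of_nonneg]
  · simp only [e]
    rw [tsum_mul_left, s1.tsum_add s2, tsum_mul_left, e2, ← G, u₀_eq hn hy, kernelY,
      Real.rpow_sub_one hy0.ne']
    congr 1
    have := (G_pos hn hy).ne'
    field_simp
  · intro m
    have := hd m
    positivity
  · simp only [e]
    exact (s1.add s2).mul_left _

lemma lintegral_kernelY_mul_sq_lt_top {n : ℕ} (hn : 2 ≤ n) (h6 : 6 ≤ n) {α : ℝ} (hα : 0 < α) :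
    ∫⁻ y in Ioo (0 : ℝ) 1, ENNReal.ofReal (y ^ (α - 1) * kernelY n y * (y / (1 - y)) ^ 2) < ∞ := by
  have hn' : (6 : ℝ) ≤ n := by exact_mod_cast h6
  have h1 := lintegral_tsum_rpow_mul (gammaCoeff_sub_one_nonneg hn) (p := α + 2)
    (q := ((n : ℝ) - 5) / 2) (by positivity) (by linarith)
  have h2 : ∀ m : ℕ, ENNReal.ofReal (gammaCoeff n (n - 1) m *
      (Real.Gamma (α + 2) * Real.Gamma (((n : ℝ) - 5) / 2 + m) /
        Real.Gamma (α + 2 + (((n : ℝ) - 5) / 2 + m)))) ≤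
      ENNReal.ofReal (4 * (α * (α + 1))) * ENNReal.ofReal (gammaCoeff n (n - 1) m * (Real.Gamma α *
      Real.Gamma (((n : ℝ) - 1) / 2 + m) / Real.Gamma (α + (((n : ℝ) - 1) / 2 + m)))) :=
    fun m => by
    have hm := Nat.cast_nonneg (α := ℝ) m
    set q := ((n : ℝ) - 5) / 2 + m with hq_def
    -- From `n ≥ 6`. Hence `4 (q + 1) q ≥ 1`, which is where the factor `4` comes from.
    have hq : 1 / 2 ≤ q := by linarith
    have hq0 : 0 < q := by linarith
    rw [← ENNReal.ofReal_mul (by positivity)]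
    refine ENNReal.ofReal_le_ofReal ?_
    rw [show ((n : ℝ) - 1) / 2 + m = q + 1 + 1 by rw [hq_def]; ring,
      show α + 2 = α + 1 + 1 by ring, Real.Gamma_add_one (by positivity : α + 1 ≠ 0),
      Real.Gamma_add_one hα.ne', Real.Gamma_add_one (by positivity : q + 1 ≠ 0),
      Real.Gamma_add_one hq0.ne', show α + 1 + 1 + q = α + (q + 1 + 1) by ring]
    have hc := gammaCoeff_sub_one_nonneg hn m
    have hΓ : 0 < Real.Gamma (α + (q + 1 + 1)) := Real.Gamma_pos_of_pos (by positivity)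
    have hΓq := Real.Gamma_pos_of_pos hq0
    have hΓα := Real.Gamma_pos_of_pos hα
    set Z := gammaCoeff n (n - 1) m * (α * (α + 1)) * Real.Gamma α * Real.Gamma q /
      Real.Gamma (α + (q + 1 + 1)) with hZ
    have hZ0 : 0 ≤ Z := by positivity
    have l : gammaCoeff n (n - 1) m * ((α + 1) * (α * Real.Gamma α) * Real.Gamma q /
      Real.Gamma (α + (q + 1 + 1))) = Z := by rw [hZ]; ring
    have r : 4 * (α * (α + 1)) * (gammaCoeff n (n - 1) m * (Real.Gamma α *
      ((q + 1) * (q * Real.Gamma q)) / Real.Gamma (α + (q + 1 + 1)))) =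
      4 * ((q + 1) * q) * Z := by rw [hZ]; ring
    rw [l, r]
    exact le_mul_of_one_le_left hZ0 (by nlinarith)
  have h3 := ENNReal.tsum_le_tsum h2
  rw [ENNReal.tsum_mul_left, tsum_gammaCoeff_eq_mellinY hn hα, ← h1] at h3
  refine lt_of_le_of_lt (le_of_eq ?_) (h3.trans_lt (by finiteness))
  refine setLIntegral_congr_fun measurableSet_Ioo fun y hy => ?_
  have hx : 0 < 1 - y := by linarith [hy.2]
  have hy0 := hy.1
  have e : ∀ m : ℕ, gammaCoeff n (n - 1) m *
      (y ^ (α + 2 - 1) * (1 - y) ^ (((n : ℝ) - 5) / 2 + m - 1)) =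
      y ^ (α - 1) * (1 - y) ^ (((n : ℝ) - 3) / 2) * (y / (1 - y)) ^ 2 *
        (gammaCoeff n (n - 1) m * (1 - y) ^ m) := fun m => by
    rw [show ((n : ℝ) - 5) / 2 + m - 1 = ((n : ℝ) - 3) / 2 + m - (2 : ℕ) by push_cast; ring,
      Real.rpow_sub_natCast hx.ne', Real.rpow_add hx, Real.rpow_natCast,
      show α + 2 - 1 = α - 1 + (2 : ℕ) by push_cast; ring, Real.rpow_add_natCast hy0.ne']
    field_simp
  simp only [e]
  rw [← ENNReal.ofReal_tsum_of_nonneg, tsum_mul_left, kernelY, G]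
  · congr 1; ring
  · intro m
    have := gammaCoeff_sub_one_nonneg hn m
    positivity
  · exact (summable_G hn hy).mul_left _

lemma lintegral_rpow_eq_top {s t : ℝ} (hs : s ≤ -1) (ht : 0 < t) :
    ∫⁻ x in Ioo 0 t, ENNReal.ofReal (x ^ s) = ∞ := by
  by_contra h
  have : IntegrableOn (fun x : ℝ => x ^ s) (Ioo 0 t) := by
    refine ⟨by fun_prop, ?_⟩
    rw [hasFiniteIntegral_iff_ofReal]
    · exact lt_top_iff_ne_top.2 h
    · filter_upwards [ae_restrict_mem measurableSet_Ioo] with x hx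
      exact Real.rpow_nonneg hx.1.le _
  rw [intervalIntegral.integrableOn_Ioo_rpow_iff ht] at this
  linarith

lemma lintegral_measureY {n : ℕ} (hn : 2 ≤ n) {α : ℝ} (hα : 0 < α) {f : ℝ → ℝ≥0∞}
    (hf : AEMeasurable f (volume.restrict (Ioo 0 1))) :
    ∫⁻ y, f y ∂(measureY n α) = ENNReal.ofReal (mellinY n α)⁻¹ *
      ∫⁻ y in Ioo (0 : ℝ) 1, ENNReal.ofReal (y ^ (α - 1) * kernelY n y) * f y := by
  have hk := aemeasurable_kernelY hn
  have hM := mellinY_pos hn hα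
  have hk' : AEMeasurable (fun y : ℝ => ENNReal.ofReal (y ^ (α - 1) * kernelY n y))
      (volume.restrict (Ioo 0 1)) := by fun_prop
  rw [measureY, lintegral_withDensity_eq_lintegral_mul₀ (by fun_prop) hf,
    ← lintegral_const_mul'' _ (by fun_prop)]
  refine lintegral_congr fun y => ?_
  rw [Pi.mul_apply, div_eq_inv_mul, ENNReal.ofReal_mul (inv_pos.2 hM).le, mul_assoc]

lemma ae_mem_Ioo_measureY (n : ℕ) (α : ℝ) : ∀ᵐ y ∂(measureY n α), y ∈ Ioo (0 : ℝ) 1 :=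
  (withDensity_absolutelyContinuous _ _) (ae_restrict_mem measurableSet_Ioo)

/-- Multiplying the density by `y^s` shifts `α` to `α + s`. The case `s = 0` gives total mass one.
-/
lemma lintegral_rpow_measureY {n : ℕ} (hn : 2 ≤ n) {α s : ℝ} (hα : 0 < α) (hs : 0 < α + s) :
    ∫⁻ y, ENNReal.ofReal (y ^ s) ∂(measureY n α) =
      ENNReal.ofReal (mellinY n (α + s) / mellinY n α) := by
  have hM := mellinY_pos hn hα
  rw [lintegral_measureY hn hα (by fun_prop), div_eq_inv_mul, ENNReal.ofReal_mul (inv_pos.2 hM).le,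
    ← lintegral_kernelY hn hs]
  congr 1
  refine setLIntegral_congr_fun measurableSet_Ioo fun y hy => ?_
  have hy0 := hy.1
  rw [← ENNReal.ofReal_mul (mul_nonneg (by positivity) (kernelY_pos hn hy).le),
    show α + s - 1 = α - 1 + s by ring, Real.rpow_add hy0]
  congr 1
  ring

lemma isProbabilityMeasure_measureY {n : ℕ} (hn : 2 ≤ n) {α : ℝ} (hα : 0 < α) :
    IsProbabilityMeasure (measureY n α) := by
  constructor
  have := lintegral_rpow_measureY hn hα (s := 0) (by simpa using hα)
  simpa [div_self (mellinY_pos hn hα).ne'] using this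

lemma integrable_and_integral_rpow_measureY {n : ℕ} (hn : 2 ≤ n) {α s : ℝ} (hα : 0 < α)
    (hs : 0 < α + s) : Integrable (fun y : ℝ => y ^ s) (measureY n α) ∧
      ∫ y, y ^ s ∂(measureY n α) = mellinY n (α + s) / mellinY n α := by
  have h0 : ∀ᵐ y ∂(measureY n α), 0 ≤ y ^ s := by
    filter_upwards [ae_mem_Ioo_measureY n α] with y hy
    exact Real.rpow_nonneg hy.1.le s
  have h := lintegral_rpow_measureY hn hα hs
  refine ⟨⟨by fun_prop, ?_⟩, ?_⟩
  · rw [hasFiniteIntegral_iff_ofReal h0, h]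
    exact ENNReal.ofReal_lt_top
  · rw [integral_eq_lintegral_of_nonneg_ae h0 (by fun_prop), h, ENNReal.toReal_ofReal]
    exact (div_pos (mellinY_pos hn hs) (mellinY_pos hn hα)).le

/-- The factor `k = 0` of the multiplication formula is split off; the remaining ones are the
denominators of `mellinY`. This links the Beta product to `Γ(x)^n / Γ(nx)`, the form that arises
from the sample. -/
lemma exists_mellinY_mul_Gamma_eq {n : ℕ} (hn : 2 ≤ n) : ∃ c : ℝ, 0 < c ∧ ∀ x : ℝ, 0 < x →
    mellinY n x * Real.Gamma (n * x) = c * (n : ℝ) ^ (n * x) * Real.Gamma x ^ n := by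
  obtain ⟨C, hC, h⟩ := exists_Gamma_nat_mul_eq (n := n) (by omega)
  have hn' : (0 : ℝ) < n := by exact_mod_cast (by omega : 0 < n)
  refine ⟨C * ∏ k ∈ Finset.range (n - 1), Real.Gamma (((k : ℝ) + 1) / n),
    mul_pos hC (Finset.prod_pos fun k _ => Real.Gamma_pos_of_pos (by positivity)), fun x hx => ?_⟩
  obtain ⟨j, rfl⟩ : ∃ j, n = j + 1 := ⟨n - 1, by omega⟩
  rw [h x hx, Finset.prod_range_succ', mellinY, Finset.prod_div_distrib]
  simp only [add_tsub_cancel_right, Nat.cast_add, Nat.cast_one, Nat.cast_zero, zero_div, add_zero]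
  have : ∏ k ∈ Finset.range j, Real.Gamma (x + ((k : ℝ) + 1) / ((j : ℝ) + 1)) ≠ 0 :=
    (Finset.prod_pos fun k _ => Real.Gamma_pos_of_pos (by positivity)).ne'
  field_simp
  exact (pow_succ _ _).symm

/-! ### Independence of `X` and `Y`. -/

lemma integrable_and_integral_exp_gammaMeasure {a r s t : ℝ} (ha : 0 < a) (hr : 0 < r)
    (hs : 0 < a + s) (ht : 0 < r - t) :
    Integrable (fun x => Real.exp (s * Real.log x + t * x)) (gammaMeasure a r) ∧
    ∫ x, Real.exp (s * Real.log x + t * x) ∂(gammaMeasure a r) =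
      (tiltConst a r (a + s) (r - t))⁻¹ := by
  have hK := tiltConst_pos ha hr hs ht
  have := isProbabilityMeasure_gammaMeasure hs ht
  have h1 : (gammaMeasure (a + s) (r - t)) univ = 1 := measure_univ
  rw [gammaMeasure_eq_withDensity ha hr hs ht, withDensity_apply _ MeasurableSet.univ,
    Measure.restrict_univ] at h1
  simp only [add_sub_cancel_left, sub_sub_cancel, ENNReal.ofReal_mul hK.le] at h1
  rw [lintegral_const_mul _ (by fun_prop), mul_comm] at h1
  have h2 := ENNReal.eq_inv_of_mul_eq_one_left h1
  rw [← ENNReal.ofReal_inv_of_pos hK] at h2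
  have h0 : ∀ᵐ x ∂(gammaMeasure a r), 0 ≤ Real.exp (s * Real.log x + t * x) :=
    .of_forall fun x => (Real.exp_pos _).le
  refine ⟨⟨by fun_prop, ?_⟩, ?_⟩
  · rw [hasFiniteIntegral_iff_ofReal h0, h2]
    exact ENNReal.ofReal_lt_top
  · rw [integral_eq_lintegral_of_nonneg_ae h0 (by fun_prop), h2, ENNReal.toReal_ofReal]
    positivity

lemma integrable_and_integral_exp_law (n : ℕ) {a r s t : ℝ} (ha : 0 < a) (hr : 0 < r)
    (hs : 0 < a + s) (ht : 0 < r - t) :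
    Integrable (fun x => Real.exp (s * logSum x + t * statX x)) (law n (a, r)) ∧
    ∫ x, Real.exp (s * logSum x + t * statX x) ∂(law n (a, r)) =
      (tiltConst a r (a + s) (r - t) ^ n)⁻¹ := by
  have hK := tiltConst_pos ha hr hs ht
  have := isProbabilityMeasure_law n hs ht
  obtain ⟨h1, h2⟩ := integrable_law_iff_and_integral_law_eq n ha hr hs ht (fun _ => 1)
  simp only [add_sub_cancel_left, sub_sub_cancel, one_mul, integral_const, probReal_univ,
    smul_eq_mul] at h1 h2
  exact ⟨h1.1 (integrable_const _), eq_inv_of_mul_eq_one_right h2.symm⟩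

/-- Since `∑ log Xᵢ = log Y + n log (X/n)`, this factorization of the joint transform of `(∑ log Xᵢ,
X)` into a Gamma(`na`, `r`) part and a moment of `Y` expresses the independence of `X` and `Y`. -/
lemma tiltConst_pow_eq {n : ℕ} (hn : 2 ≤ n) {a r s t : ℝ} (ha : 0 < a) (hr : 0 < r)
    (hs : 0 < a + s) (ht : 0 < r - t) :
    (tiltConst a r (a + s) (r - t) ^ n)⁻¹ =
      (tiltConst (n * a) r (n * a + n * s) (r - t))⁻¹ *
        ((n : ℝ) ^ (-(n * s)) * (mellinY n (a + s) / mellinY n a)) := by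
  have hn' : (0 : ℝ) < n := by exact_mod_cast (by omega : 0 < n)
  obtain ⟨c, hc, h⟩ := exists_mellinY_mul_Gamma_eq hn
  have h1 := h a ha
  have h2 := h (a + s) hs
  have hM1 := mellinY_pos hn ha
  have hΓ1 : 0 < Real.Gamma (n * a) := Real.Gamma_pos_of_pos (by positivity)
  have hΓ2 : 0 < Real.Gamma (n * (a + s)) := Real.Gamma_pos_of_pos (by positivity)
  have hg1 := Real.Gamma_pos_of_pos ha
  have hg2 := Real.Gamma_pos_of_pos hs
  rw [← eq_div_iff hΓ1.ne'] at h1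
  rw [← eq_div_iff hΓ2.ne'] at h2
  have hr1 : r ^ (n * a) = (r ^ a) ^ n := by
    rw [mul_comm, Real.rpow_mul hr.le, Real.rpow_natCast]
  have hr2 : (r - t) ^ (n * (a + s)) = ((r - t) ^ (a + s)) ^ n := by
    rw [mul_comm, Real.rpow_mul ht.le, Real.rpow_natCast]
  have hrp := Real.rpow_pos_of_pos hr a
  have htp := Real.rpow_pos_of_pos ht (a + s)
  have hn1 : (n : ℝ) ^ (n * (a + s)) = (n : ℝ) ^ (n * a) * (n : ℝ) ^ (n * s) := by
    rw [← Real.rpow_add hn', mul_add]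
  have hp1 := Real.rpow_pos_of_pos hn' (n * a)
  have hp2 := Real.rpow_pos_of_pos hn' (n * s)
  rw [tiltConst, tiltConst, ← mul_add, h1, h2, hr1, hr2, hn1, Real.rpow_neg hn'.le,
    mul_pow, div_pow, div_pow]
  field_simp

/-- The joint law of `∑ log Xᵢ` and `∑ Xᵢ`. -/
lemma map_logSum_statX {n : ℕ} (hn : 2 ≤ n) {a r : ℝ} (ha : 0 < a) (hr : 0 < r) :
    (law n (a, r)).map (fun x => (logSum x, statX x)) =
      ((gammaMeasure (n * a) r).prod (measureY n a)).map
        (fun p : ℝ × ℝ => (Real.log p.2 + n * Real.log (p.1 / n), p.1)) := by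
  have hn' : (0 : ℝ) < n := by exact_mod_cast (by omega : 0 < n)
  have hna : 0 < n * a := by positivity
  have := isProbabilityMeasure_law n ha hr
  have := isProbabilityMeasure_gammaMeasure hna hr
  have := isProbabilityMeasure_measureY hn ha
  have hm1 : Measurable fun x : Fin n → ℝ => (logSum x, statX x) := by fun_prop
  have hm2 : Measurable fun p : ℝ × ℝ => (Real.log p.2 + n * Real.log (p.1 / n), p.1) := by fun_prop
  have hexp : ∀ s t : ℝ, Measurable fun p : ℝ × ℝ => Real.exp (s * p.1 + t * p.2) := by
    intro s t; fun_prop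
  have hbd : ∀ s t, |s| < min a r → |t| < min a r → 0 < a + s ∧ 0 < r - t := fun s t hs ht => by
    rw [abs_lt] at hs ht
    constructor <;> linarith [min_le_left a r, min_le_right a r]
  have hae : ∀ s t : ℝ, (fun p : ℝ × ℝ => Real.exp (n * s * Real.log p.1 + t * p.1) *
      ((n : ℝ) ^ (-(n * s)) * p.2 ^ s)) =ᵐ[(gammaMeasure (n * a) r).prod (measureY n a)]
      fun p => Real.exp (s * (Real.log p.2 + n * Real.log (p.1 / n)) + t * p.1) := fun s t => by
    have h1 : ∀ᵐ p ∂((gammaMeasure (n * a) r).prod (measureY n a)), 0 < p.1 :=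
      Measure.quasiMeasurePreserving_fst.ae (ae_pos_gammaMeasure _ _)
    have h2 : ∀ᵐ p ∂((gammaMeasure (n * a) r).prod (measureY n a)), p.2 ∈ Ioo (0 : ℝ) 1 :=
      Measure.quasiMeasurePreserving_snd.ae (ae_mem_Ioo_measureY n a)
    filter_upwards [h1, h2] with p hp1 hp2
    rw [Real.rpow_def_of_pos hn', Real.rpow_def_of_pos hp2.1, ← Real.exp_add, ← Real.exp_add,
      Real.log_div hp1.ne' hn'.ne']
    congr 1
    ring
  have hprod : ∀ s t, 0 < a + s → 0 < r - t →
      Integrable (fun p : ℝ × ℝ => Real.exp (n * s * Real.log p.1 + t * p.1) *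
        ((n : ℝ) ^ (-(n * s)) * p.2 ^ s)) ((gammaMeasure (n * a) r).prod (measureY n a)) ∧
      ∫ p : ℝ × ℝ, Real.exp (n * s * Real.log p.1 + t * p.1) *
        ((n : ℝ) ^ (-(n * s)) * p.2 ^ s) ∂((gammaMeasure (n * a) r).prod (measureY n a)) =
      (tiltConst a r (a + s) (r - t) ^ n)⁻¹ := fun s t hs ht => by
    have hns : 0 < n * a + n * s := by rw [← mul_add]; positivity
    obtain ⟨i1, e1⟩ := integrable_and_integral_exp_gammaMeasure hna hr hns ht
    obtain ⟨i2, e2⟩ := integrable_and_integral_rpow_measureY hn ha hs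
    refine ⟨i1.mul_prod (i2.const_mul _), ?_⟩
    rw [integral_prod_mul (fun x => Real.exp (n * s * Real.log x + t * x))
      (fun y : ℝ => (n : ℝ) ^ (-(n * s)) * y ^ s), e1, integral_const_mul, e2,
      tiltConst_pow_eq hn ha hr hs ht]
  have hε : 0 < min a r := lt_min ha hr
  have := Measure.isProbabilityMeasure_map (μ := law n (a, r)) hm1.aemeasurable
  have := Measure.isProbabilityMeasure_map
    (μ := (gammaMeasure (n * a) r).prod (measureY n a)) hm2.aemeasurable
  refine measure_ext_of_integral_exp_eq hε (fun s t hs ht => ?_) (fun s t hs ht => ?_)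
    (fun s t hs ht => ?_)
  · obtain ⟨h1, h2⟩ := hbd s t hs ht
    rw [integrable_map_measure (hexp s t).aestronglyMeasurable hm1.aemeasurable]
    exact (integrable_and_integral_exp_law n ha hr h1 h2).1
  · obtain ⟨h1, h2⟩ := hbd s t hs ht
    rw [integrable_map_measure (hexp s t).aestronglyMeasurable hm2.aemeasurable]
    exact (hprod s t h1 h2).1.congr (hae s t)
  · obtain ⟨h1, h2⟩ := hbd s t hs ht
    rw [integral_map hm1.aemeasurable (hexp s t).aestronglyMeasurable,
      integral_map hm2.aemeasurable (hexp s t).aestronglyMeasurable,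
      ← integral_congr_ae (hae s t), (hprod s t h1 h2).2]
    exact (integrable_and_integral_exp_law n ha hr h1 h2).2

/-- On positive data, `Y` is a function of `∑ log Xᵢ` and `∑ Xᵢ`. -/
lemma statY_eq_exp {n : ℕ} {x : Fin n → ℝ} (hx : ∀ i, 0 < x i) :
    statY x = Real.exp (logSum x) / (statX x / n) ^ n := by
  rw [statY, logSum, Real.exp_sum]
  congr 1
  exact Finset.prod_congr rfl fun i _ => (Real.exp_log (hx i)).symm

/-- `X` and `Y` are independent, with a Gamma distribution and the distribution `measureY`. -/
lemma map_statX_statY {n : ℕ} (hn : 2 ≤ n) {a r : ℝ} (ha : 0 < a) (hr : 0 < r) :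
    (law n (a, r)).map (fun x => (statX x, statY x)) =
      (gammaMeasure (n * a) r).prod (measureY n a) := by
  have hn' : (0 : ℝ) < n := by exact_mod_cast (by omega : 0 < n)
  have hna : 0 < n * a := by positivity
  have := isProbabilityMeasure_gammaMeasure hna hr
  have := isProbabilityMeasure_measureY hn ha
  have h := congrArg (Measure.map fun q : ℝ × ℝ => (q.2, Real.exp q.1 / (q.2 / n) ^ n))
    (map_logSum_statX hn ha hr)
  rw [Measure.map_map (by fun_prop) (by fun_prop), Measure.map_map (by fun_prop) (by fun_prop)] at h
  have e1 : (fun x : Fin n → ℝ => (statX x, statY x)) =ᵐ[law n (a, r)]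
      (fun q : ℝ × ℝ => (q.2, Real.exp q.1 / (q.2 / n) ^ n)) ∘ fun x => (logSum x, statX x) := by
    filter_upwards [ae_pos_law n ha hr] with x hx
    simp [statY_eq_exp hx]
  have e2 : (fun q : ℝ × ℝ => (q.2, Real.exp q.1 / (q.2 / n) ^ n)) ∘
      (fun p : ℝ × ℝ => (Real.log p.2 + n * Real.log (p.1 / n), p.1))
      =ᵐ[(gammaMeasure (n * a) r).prod (measureY n a)] id := by
    have h1 : ∀ᵐ p ∂((gammaMeasure (n * a) r).prod (measureY n a)), 0 < p.1 :=
      Measure.quasiMeasurePreserving_fst.ae (ae_pos_gammaMeasure _ _)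
    have h2 : ∀ᵐ p ∂((gammaMeasure (n * a) r).prod (measureY n a)), p.2 ∈ Ioo (0 : ℝ) 1 :=
      Measure.quasiMeasurePreserving_snd.ae (ae_mem_Ioo_measureY n a)
    filter_upwards [h1, h2] with p hp1 hp2
    have hpn : 0 < p.1 / n := by positivity
    refine Prod.ext rfl ?_
    simp only [Function.comp_apply, id]
    rw [Real.exp_add, Real.exp_log hp2.1, ← Real.log_pow, Real.exp_log (by positivity)]
    field_simp
  rw [Measure.map_congr e1, h, Measure.map_congr e2, Measure.map_id]

lemma ae_statX_statY {n : ℕ} (hn : 2 ≤ n) {a r : ℝ} (ha : 0 < a) (hr : 0 < r) :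
    ∀ᵐ x ∂(law n (a, r)), 0 < statX x ∧ statY x ∈ Ioo (0 : ℝ) 1 := by
  have hn' : (0 : ℝ) < n := by exact_mod_cast (by omega : 0 < n)
  have hna : 0 < n * a := by positivity
  have := isProbabilityMeasure_gammaMeasure hna hr
  have := isProbabilityMeasure_measureY hn ha
  have hm : Measurable fun x : Fin n → ℝ => (statX x, statY x) := by fun_prop
  have h1 : ∀ᵐ p ∂((gammaMeasure (n * a) r).prod (measureY n a)), 0 < p.1 :=
    Measure.quasiMeasurePreserving_fst.ae (ae_pos_gammaMeasure _ _)
  have h2 : ∀ᵐ p ∂((gammaMeasure (n * a) r).prod (measureY n a)), p.2 ∈ Ioo (0 : ℝ) 1 :=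
    Measure.quasiMeasurePreserving_snd.ae (ae_mem_Ioo_measureY n a)
  rw [← map_statX_statY hn ha hr] at h1 h2
  filter_upwards [ae_of_ae_map hm.aemeasurable h1, ae_of_ae_map hm.aemeasurable h2] with x p q
  exact ⟨p, q⟩

/-! ### Nonexistence for a fixed small shape. -/

/-- For a fixed shape `α ≤ 1 / n` there is no unbiased estimator of the rate. -/
lemma not_unbiasedOn_singleton_prod {n : ℕ} (hn : 2 ≤ n) {α l₁ l₂ : ℝ} (hα : 0 < α)
    (hαn : α ≤ 1 / (n : ℝ)) (h₁ : 0 ≤ l₁) (h₁₂ : l₁ < l₂) {T : (Fin n → ℝ) → ℝ}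
    (hT : UnbiasedOn n T (fun θ => θ.2) ({α} ×ˢ Ioo l₁ l₂)) : False := by
  have hn' : (0 : ℝ) < n := by exact_mod_cast (by omega : 0 < n)
  obtain ⟨l, hl₁, hl₂⟩ := exists_between h₁₂
  have hl : 0 < l := h₁.trans_lt hl₁
  have hTi : Integrable T (law n (α, l)) := (hT (α, l) ⟨rfl, hl₁, hl₂⟩).1
  -- Unbiasedness at rate `l + t` prescribes the transform of `T` as `l^(nα) (l + t)^(1 - nα)`.
  set R : ℝ → ℝ := fun t => Real.exp (n * α * Real.log l + (1 - n * α) * Real.log (l + t)) with hR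
  have hRa : AnalyticOnNhd ℝ R (Ioi 0) := fun t (ht : 0 < t) => by
    have h : AnalyticAt ℝ (fun t => Real.log (l + t)) t :=
      (analyticAt_const.add analyticAt_id).log (by simp only [Pi.add_apply, id]; positivity)
    exact (analyticAt_const.add (analyticAt_const.mul h)).rexp'
  have hneg : ∀ᵐ x ∂(law n (α, l)), -statX x < 0 := by
    filter_upwards [ae_statX_statY hn hα hl] with x hx
    linarith [hx.1]
  have hA := analyticOnNhd_integral_mul_exp hTi (W := fun x => -statX x) (by fun_prop)
    (hneg.mono fun _ => le_of_lt)
  have hlocal : ∀ t ∈ Ioo 0 (l₂ - l), ∫ x, T x * Real.exp (t * -statX x) ∂(law n (α, l)) = R t := by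
    intro t ht
    have hlt : 0 < l + t := by linarith [ht.1]
    have h1 := (hT (α, l + t) ⟨rfl, by linarith [ht.1], by linarith [ht.2]⟩).2
    rw [(integrable_law_iff_and_integral_law_eq n hα hl hα hlt T).2] at h1
    have e : ∀ x : Fin n → ℝ, (α - α) * logSum x + (l - (l + t)) * statX x = t * -statX x :=
      fun x => by ring
    simp only [e, tiltConst] at h1
    have hΓ := (Real.Gamma_pos_of_pos hα).ne'
    have hK : ((l + t) ^ α / Real.Gamma α * (Real.Gamma α / l ^ α)) ^ n =
        Real.exp (n * α * Real.log (l + t) - n * α * Real.log l) := by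
      have e2 : (l + t) ^ α / Real.Gamma α * (Real.Gamma α / l ^ α) = (l + t) ^ α / l ^ α := by
        field_simp
      rw [e2, Real.rpow_def_of_pos hlt, Real.rpow_def_of_pos hl, ← Real.exp_sub, ← Real.exp_nat_mul]
      congr 1
      ring
    rw [hK, mul_comm] at h1
    rw [eq_div_of_mul_eq (Real.exp_pos _).ne' h1]
    simp only [hR]
    nth_rewrite 1 [← Real.exp_log hlt]
    rw [← Real.exp_sub]
    congr 1
    ring
  have heq := hA.eqOn_of_preconnected_of_eventuallyEq hRa isPreconnected_Ioi
    (z₀ := (l₂ - l) / 2) (by simp only [mem_Ioi]; linarith) (by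
      filter_upwards [Ioo_mem_nhds (show 0 < (l₂ - l) / 2 by linarith)
        (show (l₂ - l) / 2 < l₂ - l by linarith)] with t ht using hlocal t ht)
  have hlim := tendsto_integral_mul_exp_atTop hTi (W := fun x => -statX x) (by fun_prop) hneg
  -- As `1 - nα ≥ 0`, the function `R` is at least `l^(nα)` once `l + t ≥ 1`, although the integral
  -- tends to `0`.
  have hge : ∀ᶠ t in Filter.atTop, Real.exp (n * α * Real.log l) ≤
      ∫ x, T x * Real.exp (t * -statX x) ∂(law n (α, l)) := by
    filter_upwards [Filter.eventually_ge_atTop 1] with t ht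
    refine le_of_le_of_eq ?_ (heq (show t ∈ Ioi (0 : ℝ) from lt_of_lt_of_le one_pos ht)).symm
    refine Real.exp_le_exp.2 (le_add_of_nonneg_right (mul_nonneg ?_ (Real.log_nonneg ?_)))
    · rw [le_div_iff₀ hn'] at hαn
      linarith
    · linarith
  exact absurd (ge_of_tendsto hlim hge) (not_le.2 (Real.exp_pos _))

/-! ### Inverse moments of `X` and orthogonality to functions of `(X, Y)`. -/

lemma integrable_and_integral_inv_gammaMeasure {a r : ℝ} (ha : 1 < a) (hr : 0 < r) :
    Integrable (fun x => x⁻¹) (gammaMeasure a r) ∧ ∫ x, x⁻¹ ∂(gammaMeasure a r) = r / (a - 1) := by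
  obtain ⟨h1, h2⟩ := integrable_and_integral_exp_gammaMeasure (s := -1) (t := 0)
    (one_pos.trans ha) hr (by linarith) (by linarith)
  have hae : (fun x => Real.exp (-1 * Real.log x + 0 * x)) =ᵐ[gammaMeasure a r] fun x => x⁻¹ := by
    filter_upwards [ae_pos_gammaMeasure a r] with x hx
    rw [zero_mul, add_zero, neg_one_mul, Real.exp_neg, Real.exp_log hx]
  refine ⟨h1.congr hae, ?_⟩
  rw [← integral_congr_ae hae, h2, tiltConst, sub_zero]
  have ha' : 0 < a - 1 := by linarith
  have hΓ := Real.Gamma_pos_of_pos ha'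
  have e : Real.Gamma a = (a - 1) * Real.Gamma (a - 1) := by
    rw [← Real.Gamma_add_one ha'.ne', sub_add_cancel]
  rw [← sub_eq_add_neg, e, Real.rpow_sub_one hr.ne']
  have := Real.rpow_pos_of_pos hr a
  field_simp

/-- A product `f (X) g (Y)` has the product of the expectations as its expectation. -/
lemma integrable_and_integral_mul_law {n : ℕ} (hn : 2 ≤ n) {a r : ℝ} (ha : 0 < a) (hr : 0 < r)
    {f g : ℝ → ℝ} (hf : Integrable f (gammaMeasure (n * a) r)) (hg : Integrable g (measureY n a)) :
    Integrable (fun x => f (statX x) * g (statY x)) (law n (a, r)) ∧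
    ∫ x, f (statX x) * g (statY x) ∂(law n (a, r)) =
      (∫ x, f x ∂(gammaMeasure (n * a) r)) * ∫ y, g y ∂(measureY n a) := by
  have hn' : (0 : ℝ) < n := by exact_mod_cast (by omega : 0 < n)
  have := isProbabilityMeasure_gammaMeasure (mul_pos hn' ha) hr
  have := isProbabilityMeasure_measureY hn ha
  have hm : Measurable fun x : Fin n → ℝ => (statX x, statY x) := by fun_prop
  have h := hf.mul_prod hg
  rw [← integral_prod_mul]
  rw [← map_statX_statY hn ha hr] at h ⊢
  exact ⟨h.comp_aemeasurable hm.aemeasurable, (integral_map hm.aemeasurable h.1).symm⟩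

/-- A statistic that is an unbiased estimator of `0` is orthogonal to all functions of `(X, Y)`. -/
lemma integral_mul_stat_eq_zero {n : ℕ} {S : Set (ℝ × ℝ)} (hS : S ⊆ parameterSpace)
    {θ : ℝ × ℝ} (hθ : θ ∈ interior S) {D : (Fin n → ℝ) → ℝ}
    (hD : UnbiasedOn n D (fun _ => 0) S) {φ : ℝ × ℝ → ℝ} (hφ : Measurable φ)
    (hi : Integrable (fun x => D x * φ (statX x, statY x)) (law n θ)) :
    ∫ x, D x * φ (statX x, statY x) ∂(law n θ) = 0 := by
  obtain ⟨α, l⟩ := θ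
  obtain ⟨ε, hε, hball⟩ := Metric.mem_nhds_iff.1 (mem_interior_iff_mem_nhds.1 hθ)
  obtain ⟨hα, hl⟩ : 0 < α ∧ 0 < l := hS (interior_subset hθ)
  have hbox : ∀ s t, |s| < ε → |t| < ε → (α + s, l - t) ∈ S := fun s t hs ht => hball (by
    simp [Prod.dist_eq, hs, ht])
  have key : ∀ s t, |s| < ε → |t| < ε →
      Integrable (fun x => D x * Real.exp (s * logSum x + t * statX x)) (law n (α, l)) ∧
      ∫ x, D x * Real.exp (s * logSum x + t * statX x) ∂(law n (α, l)) = 0 := fun s t hs ht => by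
    obtain ⟨h1, h2⟩ : 0 < α + s ∧ 0 < l - t := hS (hbox s t hs ht)
    obtain ⟨i1, i2⟩ := integrable_law_iff_and_integral_law_eq n hα hl h1 h2 D
    obtain ⟨j1, j2⟩ := hD _ (hbox s t hs ht)
    rw [add_sub_cancel_left, sub_sub_cancel] at i1 i2
    rw [j2] at i2
    have := (pow_pos (tiltConst_pos hα hl h1 h2) n).ne'
    exact ⟨i1.1 j1, (mul_eq_zero.1 i2.symm).resolve_left this⟩
  have hae : (fun x => D x * φ (statX x, statY x)) =ᵐ[law n (α, l)] fun x => D x *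
      (fun q : ℝ × ℝ => φ (q.2, Real.exp q.1 / (q.2 / n) ^ n)) (logSum x, statX x) := by
    filter_upwards [ae_pos_law n hα hl] with x hx
    simp only [statY_eq_exp hx]
  rw [integral_congr_ae hae]
  exact integral_mul_comp_eq_zero measurable_logSum measurable_statX hε
    (fun s t hs ht => (key s t hs ht).1) (fun s t hs ht => (key s t hs ht).2)
    (φ := fun q : ℝ × ℝ => φ (q.2, Real.exp q.1 / (q.2 / n) ^ n)) (hφ.comp (by fun_prop))
    (hi.congr hae)

/-! ### Nonexistence for `n = 2, 3`. -/

/-- Log-convexity of Gamma between `x` and `x + 1`. -/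
lemma Gamma_add_le_Gamma_mul_rpow {x u : ℝ} (hx : 0 < x) (hu0 : 0 < u) (hu1 : u < 1) :
    Real.Gamma (x + u) ≤ Real.Gamma x * x ^ u := by
  have h := Real.Gamma_mul_add_mul_le_rpow_Gamma_mul_rpow_Gamma hx (by positivity : 0 < x + 1)
    (by linarith : 0 < 1 - u) hu0 (by ring)
  have hΓ := Real.Gamma_pos_of_pos hx
  rw [Real.Gamma_add_one hx.ne', Real.mul_rpow hx.le hΓ.le, Real.rpow_sub hΓ, Real.rpow_one,
    show (1 - u) * x + u * (x + 1) = x + u by ring] at h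
  have := (Real.rpow_pos_of_pos hΓ u).ne'
  refine h.trans (le_of_eq ?_)
  field_simp

/-- Each quotient `Γ(x)/Γ(x + k/n)` is at least `x^(-k/n)`. The exponents add up to `(n - 1)/2 ≤ 1`,
so the linear factor compensates the decay. -/
lemma exists_le_mul_mellinY {n : ℕ} (h : n = 2 ∨ n = 3) :
    ∃ c : ℝ, 0 < c ∧ ∀ x : ℝ, 1 ≤ x → c ≤ (n * x - 1) * mellinY n x := by
  have key : ∀ x u : ℝ, 1 ≤ x → 0 < u → u < 1 →
      x ^ (-u) ≤ Real.Gamma x / Real.Gamma (x + u) := fun x u hx hu0 hu1 => by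
    have hx0 : 0 < x := by linarith
    have hΓ := Real.Gamma_pos_of_pos hx0
    have hΓ' := Real.Gamma_pos_of_pos (by positivity : 0 < x + u)
    rw [le_div_iff₀ hΓ', Real.rpow_neg hx0.le, inv_mul_le_iff₀ (by positivity), mul_comm]
    exact Gamma_add_le_Gamma_mul_rpow hx0 hu0 hu1
  rcases h with rfl | rfl
  · refine ⟨Real.Gamma (1 / 2), Real.Gamma_pos_of_pos (by norm_num), fun x hx => ?_⟩
    have hx0 : 0 < x := by linarith
    have h1 := key x (1 / 2) hx (by norm_num) (by norm_num)
    have h2 : x ^ (-1 : ℝ) ≤ x ^ (-(1 / 2) : ℝ) := Real.rpow_le_rpow_of_exponent_le hx (by norm_num)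
    rw [Real.rpow_neg_one] at h2
    have hc := Real.Gamma_pos_of_pos (show (0 : ℝ) < 1 / 2 by norm_num)
    have e : mellinY 2 x = Real.Gamma (1 / 2) * (Real.Gamma x / Real.Gamma (x + 1 / 2)) := by
      simp [mellinY]; ring
    rw [e]
    have h3 : 1 ≤ (((2 : ℕ) : ℝ) * x - 1) * x⁻¹ := by
      rw [← div_eq_mul_inv, le_div_iff₀ hx0]; push_cast; linarith
    have h4 : (0 : ℝ) ≤ ((2 : ℕ) : ℝ) * x - 1 := by push_cast; linarith
    calc Real.Gamma (1 / 2) ≤ Real.Gamma (1 / 2) * ((((2 : ℕ) : ℝ) * x - 1) * x⁻¹) :=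
          le_mul_of_one_le_right hc.le h3
      _ ≤ Real.Gamma (1 / 2) * ((((2 : ℕ) : ℝ) * x - 1) *
          (Real.Gamma x / Real.Gamma (x + 1 / 2))) := by gcongr; exact h2.trans h1
      _ = _ := by ring
  · have hc1 := Real.Gamma_pos_of_pos (show (0 : ℝ) < 1 / 3 by norm_num)
    have hc2 := Real.Gamma_pos_of_pos (show (0 : ℝ) < 2 / 3 by norm_num)
    refine ⟨Real.Gamma (1 / 3) * Real.Gamma (2 / 3), by positivity, fun x hx => ?_⟩
    have hx0 : 0 < x := by linarith
    have h1 := key x (1 / 3) hx (by norm_num) (by norm_num)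
    have h2 := key x (2 / 3) hx (by norm_num) (by norm_num)
    have h12 := mul_le_mul h1 h2 (by positivity) ((by positivity : 0 ≤ x ^ (-(1 / 3) : ℝ)).trans h1)
    rw [← Real.rpow_add hx0, show (-(1 / 3) + -(2 / 3) : ℝ) = -1 by norm_num,
      Real.rpow_neg_one] at h12
    have e : mellinY 3 x = Real.Gamma (1 / 3) * Real.Gamma (2 / 3) *
        (Real.Gamma x / Real.Gamma (x + 1 / 3) * (Real.Gamma x / Real.Gamma (x + 2 / 3))) := by
      simp [mellinY, Finset.prod_range_succ]; norm_num; ring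
    rw [e]
    have h3 : 1 ≤ (((3 : ℕ) : ℝ) * x - 1) * x⁻¹ := by
      rw [← div_eq_mul_inv, le_div_iff₀ hx0]; push_cast; linarith
    have h4 : (0 : ℝ) ≤ ((3 : ℕ) : ℝ) * x - 1 := by push_cast; linarith
    have hc : 0 ≤ Real.Gamma (1 / 3) * Real.Gamma (2 / 3) := by positivity
    calc Real.Gamma (1 / 3) * Real.Gamma (2 / 3)
        ≤ Real.Gamma (1 / 3) * Real.Gamma (2 / 3) * ((((3 : ℕ) : ℝ) * x - 1) * x⁻¹) :=
          le_mul_of_one_le_right hc h3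
      _ ≤ Real.Gamma (1 / 3) * Real.Gamma (2 / 3) * ((((3 : ℕ) : ℝ) * x - 1) *
          (Real.Gamma x / Real.Gamma (x + 1 / 3) * (Real.Gamma x / Real.Gamma (x + 2 / 3)))) := by
            gcongr
      _ = _ := by ring

lemma integrable_and_integral_inv_statX {n : ℕ} (hn : 2 ≤ n) {a r : ℝ} (ha : 1 < n * a)
    (hr : 0 < r) : Integrable (fun x => (statX x)⁻¹) (law n (a, r)) ∧
      ∫ x, (statX x)⁻¹ ∂(law n (a, r)) = r / (n * a - 1) := by
  have hn' : (0 : ℝ) < n := by exact_mod_cast (by omega : 0 < n)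
  have ha0 : 0 < a := pos_of_mul_pos_right (one_pos.trans ha) hn'.le
  have := isProbabilityMeasure_measureY hn ha0
  obtain ⟨h1, h2⟩ := integrable_and_integral_inv_gammaMeasure ha hr
  have := integrable_and_integral_mul_law hn ha0 hr h1 (integrable_const (1 : ℝ))
  simpa [h2] using this

/-- Moving from the shape `α + s` back to the shape `α` replaces `X ^ (-n s)` by a multiple
of `Y ^ s`. -/
lemma rpow_mul_exp_logSum_eq {n : ℕ} (hn : 2 ≤ n) {x : Fin n → ℝ} (hx : ∀ i, 0 < x i) (s : ℝ)
    (hX : 0 < statX x) : (statX x) ^ (-(n * s)) * Real.exp (s * logSum x) =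
      (n : ℝ) ^ (-(n * s)) * Real.exp (s * Real.log (statY x)) := by
  have hn' : (0 : ℝ) < n := by exact_mod_cast (by omega : 0 < n)
  rw [statY_eq_exp hx, Real.log_div (Real.exp_pos _).ne' (by positivity), Real.log_exp,
    Real.log_pow, Real.log_div hX.ne' hn'.ne', Real.rpow_def_of_pos hX, Real.rpow_def_of_pos hn',
    ← Real.exp_add, ← Real.exp_add]
  congr 1
  ring

/-- An estimator that is unbiased for the rate on an open set has a prescribed covariance with the
powers of `Y`. -/
lemma integral_mul_exp_log_statY {n : ℕ} (hn : 2 ≤ n) {T : (Fin n → ℝ) → ℝ} {α l s ε : ℝ}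
    (hα : 0 < α) (hl : 0 < l) (hs : 0 < s) (hε : 0 < ε) (hεl : ε ≤ l) (hnα : 1 < n * α)
    (hTα : Integrable T (law n (α, l)))
    (hT : UnbiasedOn n T (fun θ => θ.2) ({α + s} ×ˢ Ioo (l - ε) (l + ε))) :
    ∫ x, T x * Real.exp (s * Real.log (statY x)) ∂(law n (α, l)) = (n * (α + s) - 1) *
      ∫ x, (statX x)⁻¹ * Real.exp (s * Real.log (statY x)) ∂(law n (α, l)) := by
  have hn' : (0 : ℝ) < n := by exact_mod_cast (by omega : 0 < n)
  have hαs : 0 < α + s := by positivity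
  have hnαs : 1 < n * (α + s) := by nlinarith
  -- For known shape `α + s`, the multiple `(n(α + s) - 1)/X` is already unbiased for the rate. Thus
  -- `D` is unbiased for zero there, and completeness in the rate alone makes it orthogonal to
  -- functions of `X`.
  set D : (Fin n → ℝ) → ℝ := fun x => T x - (n * (α + s) - 1) * (statX x)⁻¹ with hD_def
  have hexp : ∀ᵐ x ∂(law n (α, l)), ‖Real.exp (s * Real.log (statY x))‖ ≤ 1 := by
    filter_upwards [ae_statX_statY hn hα hl] with x hx
    rw [Real.norm_of_nonneg (Real.exp_pos _).le, Real.exp_le_one_iff]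
    exact mul_nonpos_of_nonneg_of_nonpos hs.le (Real.log_nonpos hx.2.1.le hx.2.2.le)
  have hm : Measurable fun x : Fin n → ℝ => Real.exp (s * Real.log (statY x)) := by fun_prop
  have i1 := hTα.mul_bdd hm.aestronglyMeasurable hexp
  have i2 := (integrable_and_integral_inv_statX hn hnα hl).1.mul_bdd hm.aestronglyMeasurable hexp
  have iD : Integrable (fun x => D x * Real.exp (s * Real.log (statY x))) (law n (α, l)) := by
    refine (i1.sub (i2.const_mul (n * (α + s) - 1))).congr (.of_forall fun x => ?_)
    simp only [hD_def, Pi.sub_apply]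
    ring
  have key : ∀ t u : ℝ, |t| < ε → |u| < ε →
      Integrable (fun x => D x * Real.exp (t * statX x + u * 0)) (law n (α + s, l)) ∧
      ∫ x, D x * Real.exp (t * statX x + u * 0) ∂(law n (α + s, l)) = 0 := fun t u ht _ => by
    rw [abs_lt] at ht
    have hlt : 0 < l - t := by linarith
    obtain ⟨j1, j2⟩ := hT (α + s, l - t) ⟨rfl, by linarith, by linarith⟩
    obtain ⟨k1, k2⟩ := integrable_and_integral_inv_statX hn hnαs hlt
    have hDi : Integrable D (law n (α + s, l - t)) := j1.sub (k1.const_mul _)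
    have hD0 : ∫ x, D x ∂(law n (α + s, l - t)) = 0 := by
      rw [integral_sub j1 (k1.const_mul _), integral_const_mul, j2, k2]
      have : n * (α + s) - 1 ≠ 0 := by linarith
      field_simp
      simp
    obtain ⟨m1, m2⟩ := integrable_law_iff_and_integral_law_eq n hαs hl hαs hlt D
    have e : ∀ x : Fin n → ℝ, (α + s - (α + s)) * logSum x + (l - (l - t)) * statX x =
        t * statX x + u * 0 := fun x => by ring
    simp only [e] at m1 m2
    rw [hD0] at m2
    have := (pow_pos (tiltConst_pos hαs hl hαs hlt) n).ne'
    exact ⟨m1.1 hDi, (mul_eq_zero.1 m2.symm).resolve_left this⟩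
  obtain ⟨m1, m2⟩ := integrable_law_iff_and_integral_law_eq n hα hl hαs hl
    (fun x => D x * (statX x) ^ (-(n * s)))
  have hae : (fun x : Fin n → ℝ => D x * (statX x) ^ (-(n * s)) *
      Real.exp ((α + s - α) * logSum x + (l - l) * statX x)) =ᵐ[law n (α, l)]
      fun x => (n : ℝ) ^ (-(n * s)) * (D x * Real.exp (s * Real.log (statY x))) := by
    filter_upwards [ae_pos_law n hα hl, ae_statX_statY hn hα hl] with x hx hx'
    rw [add_sub_cancel_left, sub_self, zero_mul, add_zero, mul_assoc,
      rpow_mul_exp_logSum_eq hn hx s hx'.1]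
    ring
  -- The test function `X^(-ns)` is chosen because the change of shape back to `α` turns it into a
  -- multiple of `Y^s`. The dummy `V = 0` reduces the plane statement to `X` alone.
  have hz := integral_mul_comp_eq_zero measurable_statX (V := fun _ => 0) measurable_const hε
    (fun t u ht hu => (key t u ht hu).1) (fun t u ht hu => (key t u ht hu).2)
    (φ := fun q => q.1 ^ (-(n * s))) (by fun_prop) (m1.2 ((iD.const_mul _).congr hae.symm))
  rw [m2, integral_congr_ae hae, integral_const_mul] at hz
  have h0 : ∫ x, D x * Real.exp (s * Real.log (statY x)) ∂(law n (α, l)) = 0 := by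
    have h1 := (pow_pos (tiltConst_pos hα hl hαs hl) n).ne'
    have h2 := (Real.rpow_pos_of_pos hn' (-(n * s))).ne'
    exact (mul_eq_zero.1 ((mul_eq_zero.1 hz).resolve_left h1)).resolve_left h2
  rw [← sub_eq_zero, ← integral_const_mul, ← integral_sub i1 (i2.const_mul _), ← h0]
  refine integral_congr_ae (.of_forall fun x => ?_)
  simp only [hD_def]
  ring

/-- For `n = 2, 3` there is no unbiased estimator of the rate on a set with nonempty interior. -/
lemma not_unbiasedOn_of_le_three {n : ℕ} (h23 : n = 2 ∨ n = 3) {S : Set (ℝ × ℝ)}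
    (hS : S ⊆ parameterSpace) (hS' : (interior S).Nonempty) {T : (Fin n → ℝ) → ℝ}
    (hT : UnbiasedOn n T (fun θ => θ.2) S) : False := by
  have hn : 2 ≤ n := by omega
  have hn' : (0 : ℝ) < n := by exact_mod_cast (by omega : 0 < n)
  obtain ⟨⟨α, l⟩, hθ⟩ := hS'
  obtain ⟨ε₀, hε₀, hball⟩ := Metric.mem_nhds_iff.1 (mem_interior_iff_mem_nhds.1 hθ)
  obtain ⟨hα, hl⟩ : 0 < α ∧ 0 < l := hS (interior_subset hθ)
  set ε := min ε₀ l
  have hε : 0 < ε := lt_min hε₀ hl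
  have hεl : ε ≤ l := min_le_right _ _
  have hbox : ∀ s, |s| < ε → {α + s} ×ˢ Ioo (l - ε) (l + ε) ⊆ S := by
    rintro s hs ⟨a, b⟩ ⟨rfl : a = α + s, hb : b ∈ Ioo (l - ε) (l + ε)⟩
    refine hball ?_
    have : |b - l| < ε := abs_lt.2 ⟨by linarith [hb.1], by linarith [hb.2]⟩
    simp only [Metric.mem_ball, Prod.dist_eq, Real.dist_eq, add_sub_cancel_left]
    exact max_lt (hs.trans_le (min_le_left _ _)) (this.trans_le (min_le_left _ _))
  have hTs : ∀ s, |s| < ε → UnbiasedOn n T (fun θ => θ.2) ({α + s} ×ˢ Ioo (l - ε) (l + ε)) :=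
    fun s hs θ h => hT θ (hbox s hs h)
  have hnα : 1 < n * α := by
    by_contra hcon
    have h := hTs 0 (by simpa using hε)
    rw [add_zero] at h
    refine not_unbiasedOn_singleton_prod hn hα ?_ (by linarith) (by linarith) h
    rw [le_div_iff₀ hn']
    linarith
  have hTα : Integrable T (law n (α, l)) := (hT _ (interior_subset hθ)).1
  obtain ⟨iX, eX⟩ := integrable_and_integral_inv_statX hn hnα hl
  have hneg : ∀ᵐ x ∂(law n (α, l)), Real.log (statY x) < 0 := by
    filter_upwards [ae_statX_statY hn hα hl] with x hx
    exact Real.log_neg hx.2.1 hx.2.2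
  have hW : Measurable fun x : Fin n → ℝ => Real.log (statY x) := by fun_prop
  have hA := analyticOnNhd_integral_mul_exp hTα hW (hneg.mono fun _ => le_of_lt)
  have hB := analyticOnNhd_integral_mul_exp iX hW (hneg.mono fun _ => le_of_lt)
  have hlin : AnalyticOnNhd ℝ (fun s : ℝ => n * (α + s) - 1) (Ioi 0) := fun s _ => by fun_prop
  -- The covariance identity is known only for `0 < s < ε`; analyticity extends it to all `s > 0`.
  have heq := hA.eqOn_of_preconnected_of_eventuallyEq (hlin.mul hB) isPreconnected_Ioi
    (z₀ := ε / 2) (by simpa using hε) (by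
      filter_upwards [Ioo_mem_nhds (show 0 < ε / 2 by linarith) (show ε / 2 < ε by linarith)]
        with s hs
      exact integral_mul_exp_log_statY hn hα hl hs.1 hε hεl hnα hTα
        (hTs s (by rw [abs_of_pos hs.1]; exact hs.2)))
  have hBval : ∀ s, 0 < s → ∫ x, (statX x)⁻¹ * Real.exp (s * Real.log (statY x)) ∂(law n (α, l)) =
      l / (n * α - 1) * (mellinY n (α + s) / mellinY n α) := fun s hs => by
    obtain ⟨i2, e2⟩ := integrable_and_integral_rpow_measureY hn hα (s := s) (by positivity)
    obtain ⟨i1, e1⟩ := integrable_and_integral_inv_gammaMeasure hnα hl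
    rw [← e1, ← e2, ← (integrable_and_integral_mul_law hn hα hl i1 i2).2]
    refine integral_congr_ae ?_
    filter_upwards [ae_statX_statY hn hα hl] with x hx
    rw [Real.rpow_def_of_pos hx.2.1, mul_comm s]
  obtain ⟨c, hc, hcb⟩ := exists_le_mul_mellinY h23
  have hM := mellinY_pos hn hα
  have hd : 0 < n * α - 1 := by linarith
  have hge : ∀ᶠ s in Filter.atTop, l / (n * α - 1) / mellinY n α * c ≤
      ∫ x, T x * Real.exp (s * Real.log (statY x)) ∂(law n (α, l)) := by
    filter_upwards [Filter.eventually_ge_atTop 1] with s hs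
    have hs0 : 0 < s := by linarith
    refine le_of_le_of_eq ?_ (heq (show s ∈ Ioi (0 : ℝ) from hs0)).symm
    simp only [hBval s hs0]
    calc l / (n * α - 1) / mellinY n α * c
        ≤ l / (n * α - 1) / mellinY n α * ((n * (α + s) - 1) * mellinY n (α + s)) := by
          gcongr
          exact hcb _ (by linarith)
      _ = _ := by ring
  have hlim := tendsto_integral_mul_exp_atTop hTα hW hneg
  exact absurd (ge_of_tendsto hlim hge) (not_le.2 (by positivity))

/-! ### Unbiasedness of the estimator. -/

lemma aemeasurable_u₀ {n : ℕ} (hn : 2 ≤ n) : AEMeasurable (u₀ n) (volume.restrict (Ioo 0 1)) := by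
  obtain ⟨v, hv, e⟩ := exists_measurable_eq_u₀ hn
  refine ⟨v, hv, ?_⟩
  filter_upwards [ae_restrict_mem measurableSet_Ioo] with y hy using e y hy.2.le

lemma aemeasurable_u₀_measureY {n : ℕ} (hn : 2 ≤ n) (α : ℝ) :
    AEMeasurable (u₀ n) (measureY n α) :=
  (aemeasurable_u₀ hn).mono_ac (withDensity_absolutelyContinuous _ _)

lemma integrable_and_integral_u₀ {n : ℕ} (h4 : 4 ≤ n) {α : ℝ} (hα : 0 < α) :
    Integrable (u₀ n) (measureY n α) ∧ ∫ y, u₀ n y ∂(measureY n α) = α := by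
  have hn : 2 ≤ n := by omega
  have hn' : (4 : ℝ) ≤ n := by exact_mod_cast h4
  have hM := mellinY_pos hn hα
  have hm := aemeasurable_u₀ hn
  have hm' := aemeasurable_u₀_measureY hn α
  have h0 : ∀ᵐ y ∂(measureY n α), 0 ≤ u₀ n y := by
    filter_upwards [ae_mem_Ioo_measureY n α] with y hy
    refine le_trans (mul_nonneg (by linarith) ?_) (le_u₀ hn hy)
    exact div_nonneg hy.1.le (by linarith [hy.2])
  have h : ∫⁻ y, ENNReal.ofReal (u₀ n y) ∂(measureY n α) = ENNReal.ofReal α := by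
    rw [lintegral_measureY hn hα (by fun_prop)]
    have e : ∀ y ∈ Ioo (0 : ℝ) 1, ENNReal.ofReal (y ^ (α - 1) * kernelY n y) *
        ENNReal.ofReal (u₀ n y) = ENNReal.ofReal (y ^ (α - 1) * kernelY n y * u₀ n y) :=
      fun y hy => (ENNReal.ofReal_mul (mul_nonneg (Real.rpow_nonneg hy.1.le _)
        (kernelY_pos hn hy).le)).symm
    rw [setLIntegral_congr_fun measurableSet_Ioo e, lintegral_kernelY_mul_u₀ hn h4 hα,
      ← ENNReal.ofReal_mul (by positivity)]
    congr 1
    field_simp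
  refine ⟨⟨hm'.aestronglyMeasurable, ?_⟩, ?_⟩
  · rw [hasFiniteIntegral_iff_ofReal h0, h]
    exact ENNReal.ofReal_lt_top
  · rw [integral_eq_lintegral_of_nonneg_ae h0 hm'.aestronglyMeasurable, h,
      ENNReal.toReal_ofReal hα.le]

lemma rateEstimator_eq {n : ℕ} (x : Fin n → ℝ) :
    rateEstimator n x = (statX x)⁻¹ * (n * u₀ n (statY x) - 1) := by
  rw [rateEstimator, u₁, div_eq_inv_mul]

lemma unbiasedOn_rateEstimator {n : ℕ} (h4 : 4 ≤ n) :
    UnbiasedOn n (rateEstimator n) (fun θ => θ.2) (Ioi (1 / (n : ℝ)) ×ˢ Ioi 0) := by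
  rintro ⟨α, l⟩ ⟨hα : 1 / (n : ℝ) < α, hl : 0 < l⟩
  have hn' : (0 : ℝ) < n := by exact_mod_cast (by omega : 0 < n)
  have hα0 : 0 < α := lt_trans (by positivity) hα
  have hnα : 1 < n * α := by rwa [div_lt_iff₀' hn'] at hα
  have := isProbabilityMeasure_measureY (by omega : 2 ≤ n) hα0
  obtain ⟨i1, e1⟩ := integrable_and_integral_inv_gammaMeasure hnα hl
  obtain ⟨i2, e2⟩ := integrable_and_integral_u₀ h4 hα0
  have i3 : Integrable (fun y => n * u₀ n y - 1) (measureY n α) :=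
    (i2.const_mul _).sub (integrable_const _)
  obtain ⟨i, e⟩ := integrable_and_integral_mul_law (by omega) hα0 hl i1 i3
  rw [show rateEstimator n = fun x => (statX x)⁻¹ * (n * u₀ n (statY x) - 1) from
    funext rateEstimator_eq]
  refine ⟨i, ?_⟩
  rw [e, e1, integral_sub (i2.const_mul _) (integrable_const _), integral_const_mul, e2]
  simp only [integral_const, probReal_univ, smul_eq_mul, mul_one]
  have : n * α - 1 ≠ 0 := by linarith
  field_simp

/-- On positive data, the geometric mean is at most the arithmetic mean. -/
lemma statY_le_one {n : ℕ} (hn : 2 ≤ n) {x : Fin n → ℝ} (hx : ∀ i, 0 < x i) : statY x ≤ 1 := by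
  have hn' : (0 : ℝ) < n := by exact_mod_cast (by omega : 0 < n)
  have hpos : 0 < ∑ i, x i := Finset.sum_pos (fun i _ => hx i) ⟨⟨0, by omega⟩, Finset.mem_univ _⟩
  have hprod : 0 ≤ ∏ i, x i := Finset.prod_nonneg fun i _ => (hx i).le
  have h := Real.geom_mean_le_arith_mean_weighted Finset.univ (fun _ => (n : ℝ)⁻¹) x
    (fun _ _ => by positivity) (by simp [hn'.ne']) (fun i _ => (hx i).le)
  rw [Real.finsetProd_rpow _ _ (fun i _ => (hx i).le), ← Finset.mul_sum] at h
  rw [statY, div_le_one (by positivity), div_eq_inv_mul]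
  calc ∏ i, x i = ((∏ i, x i) ^ (n : ℝ)⁻¹) ^ n := (Real.rpow_inv_natCast_pow hprod (by omega)).symm
    _ ≤ _ := pow_le_pow_left₀ (by positivity) h n

/-- Positive data satisfy `Y ≤ 1`, with equality when all observations coincide, so the measurable
version of `u₀` is needed up to and including `1`. -/
lemma exists_measurable_eq_rateEstimator {n : ℕ} (hn : 2 ≤ n) :
    ∃ u : ℝ × ℝ → ℝ, Measurable u ∧
      ∀ x : Fin n → ℝ, (∀ i, 0 < x i) → rateEstimator n x = u (statX x, statY x) := by
  obtain ⟨v, hv, e⟩ := exists_measurable_eq_u₀ hn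
  refine ⟨fun p => p.1⁻¹ * (n * v p.2 - 1), by fun_prop, fun x hx => ?_⟩
  rw [rateEstimator_eq, e _ (statY_le_one hn hx)]

/-! ### Finiteness of the variance. -/

/-- Finite variance means finite second moment, which factors by independence. -/
lemma evariance_rateEstimator_lt_top_iff {n : ℕ} (hn : 2 ≤ n) {α l : ℝ} (hα : 0 < α)
    (hl : 0 < l) :
    evariance (rateEstimator n) (law n (α, l)) < ∞ ↔
      (∫⁻ x, ENNReal.ofReal (x⁻¹ ^ 2) ∂(gammaMeasure (n * α) l)) *
        ∫⁻ y, ENNReal.ofReal ((n * u₀ n y - 1) ^ 2) ∂(measureY n α) < ∞ := by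
  have hn' : (0 : ℝ) < n := by exact_mod_cast (by omega : 0 < n)
  have := isProbabilityMeasure_law n hα hl
  have := isProbabilityMeasure_gammaMeasure (mul_pos hn' hα) hl
  have := isProbabilityMeasure_measureY hn hα
  obtain ⟨u, hu, e⟩ := exists_measurable_eq_rateEstimator hn
  have hm : Measurable fun x : Fin n → ℝ => (statX x, statY x) := by fun_prop
  have hae : (fun x => u (statX x, statY x)) =ᵐ[law n (α, l)] rateEstimator n := by
    filter_upwards [ae_pos_law n hα hl] with x hx using (e x hx).symm
  have hmeas : AEStronglyMeasurable (rateEstimator n) (law n (α, l)) :=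
    ((hu.comp hm).aestronglyMeasurable).congr hae
  have hY := aemeasurable_u₀_measureY hn α
  have hf : AEMeasurable (fun x : ℝ => ENNReal.ofReal (x⁻¹ ^ 2)) (gammaMeasure (n * α) l) := by
    fun_prop
  have hg : AEMeasurable (fun y => ENNReal.ofReal ((n * u₀ n y - 1) ^ 2)) (measureY n α) := by
    fun_prop
  rw [evariance_lt_top_iff_memLp hmeas, memLp_two_iff_integrable_sq hmeas,
    ← lintegral_prod_mul hf hg, ← map_statX_statY hn hα hl, lintegral_map' ?_ hm.aemeasurable]
  · have e2 : ∀ x : Fin n → ℝ, ENNReal.ofReal ((statX x)⁻¹ ^ 2) *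
        ENNReal.ofReal ((n * u₀ n (statY x) - 1) ^ 2) =
        ENNReal.ofReal (rateEstimator n x ^ 2) := fun x => by
      rw [← ENNReal.ofReal_mul (by positivity), rateEstimator_eq, mul_pow]
    simp only [e2]
    rw [← hasFiniteIntegral_iff_ofReal (.of_forall fun x => by positivity)]
    exact ⟨fun h => h.2, fun h => ⟨hmeas.pow 2, h⟩⟩
  · rw [map_statX_statY hn hα hl]
    exact (hf.comp_quasiMeasurePreserving Measure.quasiMeasurePreserving_fst).mul
      (hg.comp_quasiMeasurePreserving Measure.quasiMeasurePreserving_snd)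

lemma lintegral_inv_sq_gammaMeasure_lt_top_iff {a r : ℝ} (ha : 0 < a) (hr : 0 < r) :
    ∫⁻ x, ENNReal.ofReal (x⁻¹ ^ 2) ∂(gammaMeasure a r) < ∞ ↔ 2 < a := by
  constructor
  · contrapose!
    intro h
    rw [top_le_iff, gammaMeasure,
      lintegral_withDensity_eq_lintegral_mul _ (by unfold gammaPDF; fun_prop) (by fun_prop),
      ← top_le_iff]
    have hΓ := Real.Gamma_pos_of_pos ha
    -- On `(0, 1)` the exponential is at least `exp (-r)`, so the integrand dominates `c x^(a-3)`,
    -- which diverges for `a ≤ 2`.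
    set c : ℝ := r ^ a / Real.Gamma a * Real.exp (-r)
    have hc : 0 < c := by positivity
    have h1 : ∫⁻ x in Ioo (0 : ℝ) 1, ENNReal.ofReal c * ENNReal.ofReal (x ^ (a - 3)) = ∞ := by
      rw [lintegral_const_mul _ (by fun_prop), lintegral_rpow_eq_top (by linarith) one_pos,
        ENNReal.mul_top (by simpa using hc)]
    rw [← h1]
    refine le_trans (setLIntegral_mono' measurableSet_Ioo fun x hx => ?_)
      (setLIntegral_le_lintegral (Ioo 0 1) _)
    have hx0 := hx.1
    rw [Pi.mul_apply, gammaPDF_of_nonneg hx0.le, ← ENNReal.ofReal_mul hc.le,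
      ← ENNReal.ofReal_mul (by positivity)]
    refine ENNReal.ofReal_le_ofReal ?_
    have e : x ^ (a - 1) = x ^ (a - 3) * x ^ 2 := by
      rw [show a - 1 = a - 3 + (2 : ℕ) by push_cast; ring, Real.rpow_add_natCast hx0.ne']
    have h2 : Real.exp (-r) ≤ Real.exp (-(r * x)) := by
      refine Real.exp_le_exp.2 (neg_le_neg ?_)
      nlinarith [hx.2]
    calc c * x ^ (a - 3) = r ^ a / Real.Gamma a * x ^ (a - 3) * Real.exp (-r) := by
          simp only [c]; ring
      _ ≤ r ^ a / Real.Gamma a * x ^ (a - 3) * Real.exp (-(r * x)) := by gcongr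
      _ = _ := by rw [e]; field_simp
  · intro h
    have h1 := (integrable_and_integral_exp_gammaMeasure (s := -2) (t := 0) ha hr (by linarith)
      (by linarith)).1
    have hae : (fun x => Real.exp (-2 * Real.log x + 0 * x)) =ᵐ[gammaMeasure a r]
        fun x => x⁻¹ ^ 2 := by
      filter_upwards [ae_pos_gammaMeasure a r] with x hx
      rw [zero_mul, add_zero, mul_comm, ← Real.rpow_def_of_pos hx, inv_pow,
        show (-2 : ℝ) = -((2 : ℕ) : ℝ) by norm_num, Real.rpow_neg hx.le, Real.rpow_natCast]
    rw [← hasFiniteIntegral_iff_ofReal (.of_forall fun x => by positivity)]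
    exact (h1.congr hae).2

/-- Rules out the convention `0 * ∞ = 0` in the product of moments. -/
lemma lintegral_inv_sq_gammaMeasure_ne_zero {a r : ℝ} (ha : 0 < a) (hr : 0 < r) :
    ∫⁻ x, ENNReal.ofReal (x⁻¹ ^ 2) ∂(gammaMeasure a r) ≠ 0 := by
  have := isProbabilityMeasure_gammaMeasure ha hr
  intro h
  rw [lintegral_eq_zero_iff (by fun_prop)] at h
  have : ∀ᵐ _ ∂(gammaMeasure a r), False := by
    filter_upwards [h, ae_pos_gammaMeasure a r] with x hx hx0
    have : 0 < x⁻¹ ^ 2 := by positivity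
    simp only [Pi.zero_apply, ENNReal.ofReal_eq_zero] at hx
    linarith
  exact (IsProbabilityMeasure.ne_zero (gammaMeasure a r)) (by simpa using this)

lemma lintegral_one_sub_rpow (p : ℝ) :
    ∫⁻ y in Ioo (1 / 2 : ℝ) 1, ENNReal.ofReal ((1 - y) ^ p) =
      ∫⁻ x in Ioo (0 : ℝ) (1 / 2), ENNReal.ofReal (x ^ p) := by
  rw [← lintegral_indicator measurableSet_Ioo, ← lintegral_indicator measurableSet_Ioo,
    ← lintegral_sub_left_eq_self _ (1 : ℝ)]
  refine lintegral_congr fun y => ?_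
  by_cases hy : y ∈ Ioo (0 : ℝ) (1 / 2)
  · rw [indicator_of_mem hy, indicator_of_mem (show 1 - y ∈ Ioo (1 / 2 : ℝ) 1 from
      ⟨by linarith [hy.2], by linarith [hy.1]⟩),
      sub_sub_cancel]
  · rw [indicator_of_notMem hy, indicator_of_notMem]
    exact fun h => hy ⟨by linarith [h.2], by linarith [h.1]⟩

/-- The behaviour of the estimator near `Y = 1` bounds its second moment from below. -/
lemma exists_le_lintegral_sq_measureY {n : ℕ} (h4 : 4 ≤ n) {α : ℝ} (hα : 0 < α) :
    ∃ c : ℝ, 0 < c ∧ ENNReal.ofReal c *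
        ∫⁻ x in Ioo (0 : ℝ) (1 / 2), ENNReal.ofReal (x ^ (((n : ℝ) - 7) / 2)) ≤
      ∫⁻ y, ENNReal.ofReal ((n * u₀ n y - 1) ^ 2) ∂(measureY n α) := by
  have hn : 2 ≤ n := by omega
  have hn' : (4 : ℝ) ≤ n := by exact_mod_cast h4
  have hm := aemeasurable_u₀ hn
  have hM := mellinY_pos hn hα
  have hγ := gammaCoeff_sub_one_zero_pos hn
  -- On `(1/2, 1)` the three factors bound `y^(α-1)`, `G`, and, up to `(1-y)^(-2)`, the square of
  -- `y/(1-y)` from below.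
  set c : ℝ := (1 / 2) ^ α * gammaCoeff n (n - 1) 0 * (1 / 4)
  have hc : 0 < c := by positivity
  refine ⟨(mellinY n α)⁻¹ * c, by positivity, ?_⟩
  rw [lintegral_measureY hn hα (by fun_prop), ENNReal.ofReal_mul (by positivity), mul_assoc]
  gcongr
  rw [← lintegral_one_sub_rpow, ← lintegral_const_mul _ (by fun_prop)]
  refine le_trans (setLIntegral_mono' measurableSet_Ioo fun y hy => ?_)
    (lintegral_mono_set (Ioo_subset_Ioo_left (by norm_num : (0 : ℝ) ≤ 1 / 2)))
  have hy' : y ∈ Ioo (0 : ℝ) 1 := ⟨by linarith [hy.1], hy.2⟩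
  have hy0 := hy'.1
  have hx : 0 < 1 - y := by linarith [hy.2]
  have hk := kernelY_pos hn hy'
  rw [← ENNReal.ofReal_mul hc.le, ← ENNReal.ofReal_mul (by positivity)]
  refine ENNReal.ofReal_le_ofReal ?_
  have hz1 : 1 ≤ y / (1 - y) := by rw [le_div_iff₀ hx]; linarith [hy.1]
  have hz2 : 1 / 2 * (1 - y)⁻¹ ≤ y / (1 - y) := by
    rw [← div_eq_mul_inv]
    gcongr
    exact hy.1.le
  -- With `z = y/(1-y) ≥ 1` and `n ≥ 4`, `n u₀ - 1 ≥ 2z - 1 ≥ z`.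
  have hu : y / (1 - y) ≤ n * u₀ n y - 1 := by
    have h1 := le_u₀ hn hy'
    have h2 : 1 / 2 * (y / (1 - y)) ≤ ((n : ℝ) - 3) / 2 * (y / (1 - y)) := by gcongr; linarith
    nlinarith
  have hsq : 1 / 4 * ((1 - y) ^ 2)⁻¹ ≤ (n * u₀ n y - 1) ^ 2 := by
    have := pow_le_pow_left₀ (by positivity) (hz2.trans hu) 2
    refine le_of_eq_of_le ?_ this
    rw [mul_pow, inv_pow]
    norm_num
  have hk' : (1 / 2) ^ α * gammaCoeff n (n - 1) 0 * (1 - y) ^ (((n : ℝ) - 3) / 2) ≤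
      y ^ (α - 1) * kernelY n y := by
    have h1 : (1 / 2 : ℝ) ^ α ≤ y ^ (α - 1) := by
      calc (1 / 2 : ℝ) ^ α ≤ y ^ α := by gcongr; exact hy.1.le
        _ ≤ y ^ (α - 1) := Real.rpow_le_rpow_of_exponent_ge hy0 hy.2.le (by linarith)
    have h2 := gammaCoeff_le_G hn hy'
    rw [kernelY]
    calc _ = (1 / 2) ^ α * ((1 - y) ^ (((n : ℝ) - 3) / 2) * gammaCoeff n (n - 1) 0) := by ring
      _ ≤ _ := by gcongr
  calc c * (1 - y) ^ (((n : ℝ) - 7) / 2)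
      = ((1 / 2) ^ α * gammaCoeff n (n - 1) 0 * (1 - y) ^ (((n : ℝ) - 3) / 2)) *
        (1 / 4 * ((1 - y) ^ 2)⁻¹) := by
        rw [show ((n : ℝ) - 7) / 2 = ((n : ℝ) - 3) / 2 - (2 : ℕ) by push_cast; ring,
          Real.rpow_sub_natCast hx.ne']
        simp only [c]
        ring
    _ ≤ _ := by gcongr

lemma lintegral_sq_measureY_ne_zero {n : ℕ} (h4 : 4 ≤ n) {α : ℝ} (hα : 0 < α) :
    ∫⁻ y, ENNReal.ofReal ((n * u₀ n y - 1) ^ 2) ∂(measureY n α) ≠ 0 := by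
  obtain ⟨c, hc, h⟩ := exists_le_lintegral_sq_measureY h4 hα
  refine ((ENNReal.mul_pos (by simpa using hc) ?_).trans_le h).ne'
  rw [← pos_iff_ne_zero, setLIntegral_pos_iff (by fun_prop)]
  refine lt_of_lt_of_le ?_ (measure_mono (s := Ioo (0 : ℝ) (1 / 2)) fun x hx => ⟨?_, hx⟩)
  · simp
  · have := Real.rpow_pos_of_pos hx.1 (((n : ℝ) - 7) / 2)
    simpa using this

lemma lintegral_sq_measureY_eq_top {n : ℕ} (h45 : n = 4 ∨ n = 5) {α : ℝ} (hα : 0 < α) :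
    ∫⁻ y, ENNReal.ofReal ((n * u₀ n y - 1) ^ 2) ∂(measureY n α) = ∞ := by
  obtain ⟨c, hc, h⟩ := exists_le_lintegral_sq_measureY (n := n) (by omega) hα
  have hn : (n : ℝ) ≤ 5 := by exact_mod_cast (by omega : n ≤ 5)
  rw [lintegral_rpow_eq_top (by linarith) (by norm_num), ENNReal.mul_top (by simpa using hc)] at h
  exact top_le_iff.1 h

/-- Since `y G'/G` is bounded, only the term in `y/(1-y)` is singular, and its square is integrable
for `n ≥ 6`. -/
lemma lintegral_sq_measureY_lt_top {n : ℕ} (h6 : 6 ≤ n) {α : ℝ} (hα : 0 < α) :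
    ∫⁻ y, ENNReal.ofReal ((n * u₀ n y - 1) ^ 2) ∂(measureY n α) < ∞ := by
  have hn : 2 ≤ n := by omega
  have hn' : (6 : ℝ) ≤ n := by exact_mod_cast h6
  have hm := aemeasurable_u₀ hn
  have := isProbabilityMeasure_measureY hn hα
  obtain ⟨C, hC, hle⟩ := exists_u₀_le hn
  have hfin : ∫⁻ y, ENNReal.ofReal ((y / (1 - y)) ^ 2) ∂(measureY n α) < ∞ := by
    rw [lintegral_measureY hn hα (by fun_prop)]
    refine ENNReal.mul_lt_top ENNReal.ofReal_lt_top ?_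
    refine lt_of_eq_of_lt (setLIntegral_congr_fun measurableSet_Ioo fun y hy => ?_)
      (lintegral_kernelY_mul_sq_lt_top hn h6 hα)
    exact (ENNReal.ofReal_mul (mul_nonneg (Real.rpow_nonneg hy.1.le _)
      (kernelY_pos hn hy).le)).symm
  have hb : ∫⁻ y, (ENNReal.ofReal (2 * (n * ((n - 3) / 2)) ^ 2) *
      ENNReal.ofReal ((y / (1 - y)) ^ 2) + ENNReal.ofReal (2 * (n * C + 1) ^ 2)) ∂(measureY n α) <
      ∞ := by
    rw [lintegral_add_right _ measurable_const, lintegral_const_mul _ (by fun_prop)]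
    simp only [lintegral_const, measure_univ, mul_one]
    exact ENNReal.add_lt_top.2 ⟨ENNReal.mul_lt_top ENNReal.ofReal_lt_top hfin,
      ENNReal.ofReal_lt_top⟩
  refine lt_of_le_of_lt (lintegral_mono_ae ?_) hb
  filter_upwards [ae_mem_Ioo_measureY n α] with y hy
  rw [← ENNReal.ofReal_mul (by positivity), ← ENNReal.ofReal_add (by positivity) (by positivity)]
  refine ENNReal.ofReal_le_ofReal ?_
  have hz : 0 ≤ y / (1 - y) := div_nonneg hy.1.le (by linarith [hy.2])
  set z := y / (1 - y)
  have h1 := le_u₀ hn hy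
  have h2 := hle y hy
  have hcz : 0 ≤ ((n : ℝ) - 3) / 2 * z := mul_nonneg (by linarith) hz
  have habs : |n * u₀ n y - 1| ≤ n * (((n : ℝ) - 3) / 2) * z + (n * C + 1) := by
    rw [abs_le]
    have := mul_le_mul_of_nonneg_left h2 (by linarith : (0 : ℝ) ≤ n)
    have := mul_le_mul_of_nonneg_left h1 (by linarith : (0 : ℝ) ≤ n)
    have : 0 ≤ (n : ℝ) * (((n : ℝ) - 3) / 2 * z) := mul_nonneg (by linarith) hcz
    have : 0 ≤ (n : ℝ) * C := mul_nonneg (by linarith) hC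
    constructor <;> linarith
  rw [← sq_abs (n * u₀ n y - 1)]
  refine (pow_le_pow_left₀ (abs_nonneg _) habs 2).trans ?_
  nlinarith [sq_nonneg (n * (((n : ℝ) - 3) / 2) * z - (n * C + 1))]

/-! ### Completeness, minimal variance and the main theorem. -/

lemma Ioi_prod_Ioi_subset_parameterSpace (n : ℕ) :
    Ioi (1 / (n : ℝ)) ×ˢ Ioi (0 : ℝ) ⊆ parameterSpace :=
  prod_mono (Ioi_subset_Ioi (by positivity)) Subset.rfl

lemma isOpen_Ioi_prod_Ioi (n : ℕ) : IsOpen (Ioi (1 / (n : ℝ)) ×ˢ Ioi (0 : ℝ)) :=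
  isOpen_Ioi.prod isOpen_Ioi

/-- The difference of two unbiased estimators is an unbiased estimator of `0`. -/
lemma UnbiasedOn.sub {n : ℕ} {T T' : (Fin n → ℝ) → ℝ} {h : ℝ × ℝ → ℝ} {S : Set (ℝ × ℝ)}
    (hT : UnbiasedOn n T h S) (hT' : UnbiasedOn n T' h S) :
    UnbiasedOn n (fun x => T x - T' x) (fun _ => 0) S := fun θ hθ =>
  ⟨(hT θ hθ).1.sub (hT' θ hθ).1, by
    rw [integral_sub (hT θ hθ).1 (hT' θ hθ).1, (hT θ hθ).2, (hT' θ hθ).2, sub_self]⟩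

/-- Completeness: a function of `(X, Y)` that is an unbiased estimator of `0` vanishes. -/
lemma ae_eq_zero_of_unbiasedOn_zero {n : ℕ} {S : Set (ℝ × ℝ)} (hS : S ⊆ parameterSpace)
    {θ : ℝ × ℝ} (hθ : θ ∈ interior S) {D : (Fin n → ℝ) → ℝ} (hD : UnbiasedOn n D (fun _ => 0) S)
    {d : ℝ × ℝ → ℝ} (hd : Measurable d) (hDd : ∀ᵐ x ∂(law n θ), D x = d (statX x, statY x)) :
    ∀ᵐ x ∂(law n θ), D x = 0 := by
  have hDi : Integrable D (law n θ) := (hD θ (interior_subset hθ)).1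
  -- Testing against the sign of `d` turns orthogonality into `E|D| = 0`.
  have hφ : Measurable fun p : ℝ × ℝ => (SignType.sign (d p) : ℝ) := by
    have : (fun p : ℝ × ℝ => (SignType.sign (d p) : ℝ)) =
        fun p => if 0 < d p then (1 : ℝ) else if d p < 0 then -1 else 0 := by
      ext p
      rw [sign_apply]
      split_ifs <;> simp
    rw [this]
    exact Measurable.ite (measurableSet_lt measurable_const hd) measurable_const
      (Measurable.ite (measurableSet_lt hd measurable_const) measurable_const measurable_const)
  have hae : (fun x => D x * (SignType.sign (d (statX x, statY x)) : ℝ)) =ᵐ[law n θ]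
      fun x => |D x| := by
    filter_upwards [hDd] with x hx
    rw [← hx, self_mul_sign]
  have h := integral_mul_stat_eq_zero hS hθ hD hφ (hDi.abs.congr hae.symm)
  rw [integral_congr_ae hae, integral_eq_zero_iff_of_nonneg (fun x => abs_nonneg _) hDi.abs] at h
  filter_upwards [h] with x hx
  simpa using hx

/-- An unbiased estimator that is a function of `(X, Y)` has minimal variance. -/
lemma evariance_le_of_unbiasedOn {n : ℕ} {S : Set (ℝ × ℝ)} (hS : S ⊆ parameterSpace)
    {θ : ℝ × ℝ} (hθ : θ ∈ interior S) {h : ℝ × ℝ → ℝ} {T T' : (Fin n → ℝ) → ℝ}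
    (hT : UnbiasedOn n T h S) (hT' : UnbiasedOn n T' h S) {u : ℝ × ℝ → ℝ} (hu : Measurable u)
    (hTu : ∀ᵐ x ∂(law n θ), T x = u (statX x, statY x)) :
    evariance T (law n θ) ≤ evariance T' (law n θ) := by
  have hθS := interior_subset hθ
  have : IsProbabilityMeasure (law n θ) := isProbabilityMeasure_law n (hS hθS).1 (hS hθS).2
  have hTi := (hT θ hθS).1
  have hTi' := (hT' θ hθS).1
  by_cases hL : MemLp T' 2 (law n θ)
  swap
  · rw [evariance_eq_top hTi'.1 hL]
    exact le_top
  have hstat : Measurable fun x : Fin n → ℝ => (statX x, statY x) := by fun_prop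
  set m : MeasurableSpace (Fin n → ℝ) :=
    MeasurableSpace.comap (fun x : Fin n → ℝ => (statX x, statY x)) inferInstance
  have hm : m ≤ MeasurableSpace.pi := hstat.comap_le
  -- Orthogonality of `T' - T` to indicators of events in `σ(X, Y)` identifies `T` as this
  -- conditional expectation; the law of total variance then concludes.
  have hcond : T =ᵐ[law n θ] (law n θ)[T' | m] := by
    refine ae_eq_condExp_of_forall_setIntegral_eq hm hTi' (fun s _ _ => hTi.integrableOn)
      (fun s hs _ => ?_) ?_
    · have hs' := hm s hs
      obtain ⟨A, hA, rfl⟩ := hs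
      have e : ∀ x, (T' x - T x) * A.indicator (fun _ => (1 : ℝ)) (statX x, statY x) =
          ((fun x : Fin n → ℝ => (statX x, statY x)) ⁻¹' A).indicator
            (fun x => T' x - T x) x := fun x => by
        by_cases hx : (statX x, statY x) ∈ A
        · simp [hx]
        · simp [hx]
      have hz := integral_mul_stat_eq_zero hS hθ (hT'.sub hT)
        (φ := A.indicator fun _ => (1 : ℝ)) (measurable_const.indicator hA)
        (by simp only [e]; exact (hTi'.sub hTi).indicator hs')
      simp only [e] at hz
      rw [integral_indicator hs', integral_sub hTi'.integrableOn hTi.integrableOn] at hz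
      linarith
    · refine ⟨fun x => u (statX x, statY x), ?_, hTu⟩
      exact (hu.comp (comap_measurable _)).stronglyMeasurable
  have hL' : MemLp ((law n θ)[T' | m]) 2 (law n θ) := hL.condExp one_le_two
  rw [evariance_congr hcond, ← ofReal_variance hL', ← ofReal_variance hL]
  refine ENNReal.ofReal_le_ofReal ?_
  rw [← integral_condVar_add_variance_condExp hm hL]
  refine le_add_of_nonneg_left (integral_nonneg_of_ae ?_)
  exact condExp_nonneg (.of_forall fun x => sq_nonneg _)

end GammaSample

open GammaSample

theorem mainTheorem2 (n : ℕ) (hn : 2 ≤ n) :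
    -- for `n ≥ 4`, `u₁(X, Y)` is the UMVUE of `λ`, where `α > 1 / n`; it is a.s. unique
    (4 ≤ n →
      GammaSample.IsUMVUEOn n (GammaSample.rateEstimator n) (fun θ => θ.2)
        (Set.Ioi (1 / (n : ℝ)) ×ˢ Set.Ioi 0) ∧
      ∀ w : ℝ × ℝ → ℝ, Measurable w →
        GammaSample.UnbiasedOn n (fun x => w (GammaSample.statX x, GammaSample.statY x))
          (fun θ => θ.2) (Set.Ioi (1 / (n : ℝ)) ×ˢ Set.Ioi 0) →
        ∀ θ ∈ GammaSample.parameterSpace, ∀ᵐ x ∂(GammaSample.law n θ),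
          w (GammaSample.statX x, GammaSample.statY x) = GammaSample.rateEstimator n x) ∧
    -- for `n ≥ 6` its variance is finite if and only if `α > 2 / n`
    (6 ≤ n → ∀ α lam : ℝ, 0 < α → 0 < lam →
      (ProbabilityTheory.evariance (GammaSample.rateEstimator n)
          (GammaSample.law n (α, lam)) < ⊤ ↔ 2 / (n : ℝ) < α)) ∧
    -- for `n = 4, 5` its variance is infinite
    (n = 4 ∨ n = 5 → ∀ α lam : ℝ, 0 < α → 0 < lam →
      ProbabilityTheory.evariance (GammaSample.rateEstimator n)
        (GammaSample.law n (α, lam)) = ⊤) ∧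
    -- for `n = 2, 3` no estimator of `λ` is unbiased on a parameter set with nonempty interior
    (n = 2 ∨ n = 3 → ∀ S ⊆ GammaSample.parameterSpace, (interior S).Nonempty →
      ¬ ∃ T : (Fin n → ℝ) → ℝ, GammaSample.UnbiasedOn n T (fun θ => θ.2) S) ∧
    -- for a shape `α ≤ 1 / n`, no estimator is unbiased for `λ` in an interval of positive length
    (∀ α lam₁ lam₂ : ℝ, 0 < α → α ≤ 1 / (n : ℝ) → 0 ≤ lam₁ → lam₁ < lam₂ →
      ¬ ∃ T : (Fin n → ℝ) → ℝ,
        GammaSample.UnbiasedOn n T (fun θ => θ.2) ({α} ×ˢ Set.Ioo lam₁ lam₂)) := by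
  have hn' : (0 : ℝ) < n := by exact_mod_cast (by omega : 0 < n)
  refine ⟨fun h4 => ?_, fun h6 α l hα hl => ?_, fun h45 α l hα hl => ?_,
    fun h23 S hS hS' ⟨T, hT⟩ => not_unbiasedOn_of_le_three h23 hS hS' hT,
    fun α l₁ l₂ hα hαn h₁ h₁₂ ⟨T, hT⟩ => not_unbiasedOn_singleton_prod hn hα hαn h₁ h₁₂ hT⟩
  · obtain ⟨u, hu, e⟩ := exists_measurable_eq_rateEstimator hn
    have hsub := Ioi_prod_Ioi_subset_parameterSpace n
    have hint := (isOpen_Ioi_prod_Ioi n).interior_eq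
    have hunb := unbiasedOn_rateEstimator h4
    have hae : ∀ θ ∈ parameterSpace, ∀ᵐ x ∂(law n θ), rateEstimator n x = u (statX x, statY x) :=
      fun θ hθ => by
        filter_upwards [ae_pos_law n (α := θ.1) (lam := θ.2) hθ.1 hθ.2] with x hx using e x hx
    refine ⟨⟨hsub, ?_, ⟨u, hu, e⟩, hunb, fun T' hT' θ hθ => ?_⟩, fun w hw hwu θ hθ => ?_⟩
    · rw [hint]
      exact ⟨(1 / (n : ℝ) + 1, 1), by simp, by simp⟩
    · exact evariance_le_of_unbiasedOn hsub (hint.symm ▸ hθ) hunb hT' hu (hae θ (hsub hθ))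
    -- One interior parameter suffices: every other law is absolutely continuous with respect to
    -- this one, including those with `α ≤ 1/n`.
    · have hθ₀ : ((1 / (n : ℝ) + 1, 1) : ℝ × ℝ) ∈ Ioi (1 / (n : ℝ)) ×ˢ Ioi (0 : ℝ) :=
        ⟨by simp, by simp⟩
      have h0 := ae_eq_zero_of_unbiasedOn_zero hsub (hint.symm ▸ hθ₀) (hwu.sub hunb)
        (d := fun p => w p - u p) (hw.sub hu) (by
          filter_upwards [hae _ (hsub hθ₀)] with x hx
          rw [hx])
      have hac := law_absolutelyContinuous n (hsub hθ₀).1 (hsub hθ₀).2 hθ.1 hθ.2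
      filter_upwards [hac h0] with x hx
      exact sub_eq_zero.1 hx
  · rw [evariance_rateEstimator_lt_top_iff hn hα hl, ENNReal.mul_lt_top_iff,
      lintegral_inv_sq_gammaMeasure_lt_top_iff (by positivity) hl, div_lt_iff₀' hn']
    have h1 := lintegral_inv_sq_gammaMeasure_ne_zero (mul_pos hn' hα) hl
    have h2 := lintegral_sq_measureY_ne_zero (n := n) (by omega) hα
    have h3 := lintegral_sq_measureY_lt_top h6 hα
    tauto
  · rw [← top_le_iff, ← not_lt, evariance_rateEstimator_lt_top_iff hn hα hl,
      lintegral_sq_measureY_eq_top h45 hα,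
      ENNReal.mul_top (lintegral_inv_sq_gammaMeasure_ne_zero (mul_pos hn' hα) hl)]
    exact lt_irrefl _
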